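/- Let $\mathcal H$ be a separable complex Hilbert space, with inner product $\langle\cdot,\cdot\rangle$ linear in the first argument, $\mathcal L(\mathcal H)$ its bounded operators, $m,q\in\mathbb Z_+$, $U\subset\mathbb R^m$ open, and let $K:U\times U\to\mathcal L(\mathcal H)$ be a positive definite kernel, i.e. $\sum_{i,j}\langle K(x_i,x_j)v_j,v_i\rangle\ge 0$ for all finitely many distinct $x_i\in U$ and $v_i\in\mathcal H$. Let $\mathcal H_K$ be its reproducing kernel Hilbert space of functions $U\to\mathcal H$, so that $\langle K(\cdot,x)v,F\rangle_{\mathcal H_K}=\langle v,F(x)\rangle$. *Notation.* $C^q_0(U,\mathcal H)$ is the space of $F\in C^q(U,\mathcal H)$ such that $\partial^\alpha F$ vanishes at infinity on $U$ for all $|\alpha|\le q$. For a compact $\mathcal A\subset U$ with $\overline{\mathrm{Int}\,\mathcal A}=\mathcal A$, $C^q(\mathcal A,\mathcal H)$ is the space of continuous $F:\mathcal A\to\mathcal H$ that are $C^q$ on $\mathrm{Int}\,\mathcal A$ and whose derivatives $\partial^\alpha F$, $|\alpha|\le q$, extend continuously to $\mathcal A$ (the extension is again written $\partial^\alpha F$),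 with norm $\sum_{|\alpha|\le q}\sup_{\mathcal A}\|\partial^\alpha F\|$; $C^q_U(\mathcal A,\mathcal H)$ is the closure in it of $\{F|_{\mathcal A}: F\in C^q(U,\mathcal H)\}$. For $Z=U$ or $Z=\mathcal A$, $\mathfrak M^q(Z,\mathcal H)$ is the set of families $\eta=(\eta_\alpha)_{|\alpha|\le q}$ of $\mathcal H$-valued Radon measures of bounded variation on $Z$. $\int\langle F,d\eta_\alpha\rangle$ is the continuous extension of $\langle v,\eta_\alpha(B)\rangle$ for $F=v\chi_B$ to the functions $F$ that are Bochner integrable with respect to the variation $|\eta_\alpha|$. For $T:Z\to\mathcal L(\mathcal H)$, $\int T\,d\eta_\alpha\in\mathcal H$ is the weak-Bochner integral, defined by $\langle v,\int T\,d\eta_\alpha\rangle=\int\langle T(x)v,d\eta_\alpha(x)\rangle$ for all $v\in\mathcal H$; it exists if the functions $Tv$ are Bochner integrable with respect to $|\eta_\alpha|$ and the right side is continuous in $v$. $\partial_2^\beta K(x,y)$ denotes the derivative in $y$ in the weak operator sense, $\langle\partial_2^\beta K(x,y)v,u\rangle=\partial_y^\beta\langle K(x,y)v,u\rangle$, and $\partial_1^\alpha$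 the derivative in $x$ in the strong operator sense, $\partial_1^\alpha[\partial_2^\beta K(x,y)]v=\partial_x^\alpha(\partial_2^\beta K(x,y)v)$. $K$ is $C^q_0$-universal if $\mathcal H_K\subset C^q_0(U,\mathcal H)$ and for all $g\in C^q_0(U,\mathcal H)$, $\varepsilon>0$ there is $f\in\mathcal H_K$ with $\sup_{x\in U}\sum_{|\alpha|\le q}\|\partial^\alpha f(x)-\partial^\alpha g(x)\|<\varepsilon$; $K$ is $C^q$-universal if $\mathcal H_K\subset C^q(U,\mathcal H)$ and for all $g\in C^q(U,\mathcal H)$, compact $\mathcal A\subset U$ and $\varepsilon>0$ there is $f\in\mathcal H_K$ with the same inequality for the supremum over $\mathcal A$. **Theorem.** Suppose that $\mathcal H_K\subset C^q_0(U,\mathcal H)$ (resp. $\mathcal H_K\subset C^q(U,\mathcal H)$). Then the operators $\partial_1^\alpha[\partial_2^\beta K(x,y)]\in\mathcal L(\mathcal H)$, $|\alpha|,|\beta|\le q$, exist, with $x\mapsto\partial_2^\beta K(x,y)v$ in $C^q_0(U,\mathcal H)$ (resp. $C^q(U,\mathcal H)$) for all $y\in U$, $v\in\mathcal H$, and the following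 holds, where all the integrals exist and $Z=U$ (resp. $Z=\mathcal A$ is any compact subset of $U$ with $\overline{\mathrm{Int}\,\mathcal A}=\mathcal A$). (i) For every $\eta\in\mathfrak M^q(Z,\mathcal H)$ the function $$K_\eta(y)=\sum_{|\alpha|\le q}\int\partial_1^\alpha K(x,y)\,d\eta_\alpha(x),\qquad y\in U,$$ is an element of $\mathcal H_K$. (ii) For every $|\beta|\le q$ and $y\in U$, $\ \partial^\beta K_\eta(y)=\sum_{|\alpha|\le q}\int\partial_1^\alpha[\partial_2^\beta K(x,y)]\,d\eta_\alpha(x)$. (iii) $$\langle K_\eta,K_\eta\rangle_{\mathcal H_K}=\sum_{|\alpha|,|\beta|\le q}\int\Big\langle\int\partial_1^\alpha[\partial_2^\beta K(x,y)]\,d\eta_\alpha(x),d\eta_\beta(y)\Big\rangle,$$ and if $d\eta_\alpha=H_\alpha\,d\mu$ for all $|\alpha|\le q$, with a finite nonnegative measure $\mu$ on $Z$ and functions $H_\alpha:Z\to\mathcal H$ that are Bochner integrable with respect to $\mu$, then $$\langle K_\eta,K_\eta\rangle_{\mathcal H_K}=\sum_{|\alpha|,|\beta|\le q}\int\int\langle\partial_1^\alpha[\partial_2^\beta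 K(x,y)]H_\beta(y),H_\alpha(x)\rangle\,d\mu(x)\,d\mu(y).$$ (iv) $K$ is $C^q_0$-universal if and only if $\langle K_\eta,K_\eta\rangle_{\mathcal H_K}>0$ for all $\eta\in\mathfrak M^q(U,\mathcal H)$ for which the functional $F\mapsto\sum_{|\alpha|\le q}\int\langle\partial^\alpha F,d\eta_\alpha\rangle$ on $C^q_0(U,\mathcal H)$ is nonzero. (Resp. $K$ is $C^q$-universal if and only if $\langle K_\eta,K_\eta\rangle_{\mathcal H_K}>0$ for all compact $\mathcal A\subset U$ with $\overline{\mathrm{Int}\,\mathcal A}=\mathcal A$ and all $\eta\in\mathfrak M^q(\mathcal A,\mathcal H)$ for which the functional $F\mapsto\sum_{|\alpha|\le q}\int\langle\partial^\alpha F,d\eta_\alpha\rangle$ on $C^q_U(\mathcal A,\mathcal H)$ is nonzero.) -/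

import Mathlib

open MeasureTheory Filter Topology
open scoped ComplexOrder

noncomputable section

/-! ### Multi-indices, derivatives and spaces of differentiable functions -/

/-- The finite set of multi-indices `α ∈ ℕ^m` with `|α| ≤ q`. -/
def multiIndices (m q : ℕ) : Finset (Fin m → ℕ) :=
  (Fintype.piFinset fun _ : Fin m => Finset.range (q + 1)).filter fun α => ∑ i, α i ≤ q

theorem mem_multiIndices {m q : ℕ} {α : Fin m → ℕ} :
    α ∈ multiIndices m q ↔ ∑ i, α i ≤ q := by
  simp only [multiIndices, Finset.mem_filter, Fintype.mem_piFinset, Finset.mem_range,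
    and_iff_right_iff_imp]
  intro h i
  have := Finset.single_le_sum (f := α) (fun j _ => Nat.zero_le _) (Finset.mem_univ i)
  omega

/-- Multi-indices `α ∈ ℕ^m` with `|α| ≤ q`, as a (finite) type. -/
abbrev MultiIndex (m q : ℕ) : Type := ↥(multiIndices m q)

/-- The multi-index `0`. -/
def zeroIndex (m q : ℕ) : MultiIndex m q := ⟨0, mem_multiIndices.2 (by simp)⟩

section Derivatives

variable {m : ℕ} {V : Type*} [NormedAddCommGroup V] [NormedSpace ℝ V]

/-- The partial derivative `∂^{e_i} f`. -/
def partialDeriv (i : Fin m) (f : EuclideanSpace ℝ (Fin m) → V) :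
    EuclideanSpace ℝ (Fin m) → V :=
  fun x => lineDeriv ℝ f x (EuclideanSpace.single i (1 : ℝ))

/-- The iterated partial derivative `(∂^{e_1})^{α_1} ⋯ (∂^{e_m})^{α_m} f`. -/
def iterPartial (α : Fin m → ℕ) (f : EuclideanSpace ℝ (Fin m) → V) :
    EuclideanSpace ℝ (Fin m) → V :=
  (List.finRange m).foldr (fun i g => (partialDeriv i)^[α i] g) f

/-- Extension by zero of a function defined on a subset of `ℝ^m`. -/
def extendZero {S : Set (EuclideanSpace ℝ (Fin m))} (F : S → V) :
    EuclideanSpace ℝ (Fin m) → V :=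
  Function.extend Subtype.val F 0

/-- `∂^α F` for a function `F` on a set `U`. For `U` open, this depends only on the
values of `F` on `U`, and not on the way in which `F` is extended. -/
def dAlpha {U : Set (EuclideanSpace ℝ (Fin m))} (α : Fin m → ℕ) (F : U → V) : U → V :=
  fun x => iterPartial α (extendZero F) x

/-- `F ∈ C^q(U, V)`, for an open set `U`. -/
def IsCq {U : Set (EuclideanSpace ℝ (Fin m))} (q : ℕ) (F : U → V) : Prop :=
  ContDiffOn ℝ (q : WithTop ℕ∞) (extendZero F) U

/-- `F ∈ C^q_0(U, V)`, for an open set `U`: all `∂^α F`, `|α| ≤ q`, are continuous and vanish at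
infinity on `U`. -/
def IsC0q {U : Set (EuclideanSpace ℝ (Fin m))} (q : ℕ) (F : U → V) : Prop :=
  IsCq q F ∧ ∀ α : MultiIndex m q,
    Continuous (dAlpha α.1 F) ∧ Tendsto (dAlpha α.1 F) (cocompact U) (𝓝 0)

/-- A family `(G_α)` is the family of derivatives `(∂^α F)` of an element `F = G_0` of
`C^q(A, V)`: `F` is `C^q` on the interior of `A`, and `∂^α F` has the continuous extension `G_α`
to `A`. -/
def IsCqCompact {A : Set (EuclideanSpace ℝ (Fin m))} {q : ℕ} (G : MultiIndex m q → A → V) : Prop :=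
  (∀ α, Continuous (G α)) ∧
  ContDiffOn ℝ (q : WithTop ℕ∞) (extendZero (G (zeroIndex m q))) (interior A) ∧
  ∀ α, ∀ x : A, x.1 ∈ interior A → G α x = iterPartial α.1 (extendZero (G (zeroIndex m q))) x

/-- The family `(G_α)` belongs to the closure, in `C^q(A, V)`, of the set of restrictions to `A` of
the elements of `C^q(U, V)`. -/
def IsCqClosure {U A : Set (EuclideanSpace ℝ (Fin m))} (hA : A ⊆ U) {q : ℕ}
    (G : MultiIndex m q → A → V) : Prop :=
  IsCqCompact G ∧ ∀ ε > (0 : ℝ), ∃ g : U → V, IsCq q g ∧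
    ∀ x : A, ∑ α : MultiIndex m q, ‖dAlpha α.1 g (Set.inclusion hA x) - G α x‖ < ε

end Derivatives

variable {H : Type*} [NormedAddCommGroup H] [InnerProductSpace ℂ H] [CompleteSpace H]

/-! ### Vector measures and integrals -/

section Integrals

variable {Z : Type*} [MeasurableSpace Z]

/-- An `H`-valued Radon measure of bounded variation. -/
def IsRadon [TopologicalSpace Z] (η : VectorMeasure Z H) : Prop :=
  IsFiniteMeasure η.variation ∧ η.variation.Regular

/-- The real bilinear pairing `(a, b) ↦ ⟨a, b⟩`, for the inner product that is linear in its first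
and conjugate linear in its second argument (`inner ℂ` is conjugate linear in its first one). -/
def pairing (H : Type*) [NormedAddCommGroup H] [InnerProductSpace ℂ H] : H →L[ℝ] H →L[ℝ] ℂ :=
  LinearMap.mkContinuous₂
    (LinearMap.mk₂ ℝ (fun a b : H => inner ℂ b a)
      (fun a a' b => inner_add_right b a a')
      (fun c a b => by
        rw [← Complex.coe_smul c a, inner_smul_right, Complex.real_smul])
      (fun a b b' => inner_add_left b b' a)
      (fun c a b => by
        rw [← Complex.coe_smul c b, inner_smul_left, Complex.real_smul, Complex.conj_ofReal]))
    1 (fun a b => by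
      simpa [mul_comm] using norm_inner_le_norm (𝕜 := ℂ) b a)

/-- The integral `∫ ⟨F(z), dη(z)⟩` of an `H`-valued function against an `H`-valued measure;
it is meaningful if `F` is Bochner integrable with respect to `|η|`. -/
def bartleIntegral (F : Z → H) (η : VectorMeasure Z H) : ℂ :=
  η.integral F (pairing H)

/-- `T : Z → L(H)` is weak-Bochner integrable with respect to `η`. -/
def WeakBochnerIntegrable (T : Z → H →L[ℂ] H) (η : VectorMeasure Z H) : Prop :=
  (∀ v : H, Integrable (fun z => T z v) η.variation) ∧
    Continuous fun v : H => bartleIntegral (fun z => T z v) η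

open Classical in
/-- The weak-Bochner integral `∫ T(z) dη(z)`: the unique vector `w` of `H` with
`⟨v, w⟩ = ∫ ⟨T(z) v, dη(z)⟩` for all `v`, where `⟨·, ·⟩` is linear in its first argument. -/
def weakBochnerIntegral (T : Z → H →L[ℂ] H) (η : VectorMeasure Z H) : H :=
  if h : ∃ w : H, ∀ v : H, inner ℂ w v = bartleIntegral (fun z => T z v) η then h.choose else 0

end Integrals

/-! ### Operator valued kernels, their Hilbert spaces and their derivatives -/

/-- Positive definiteness of an operator valued kernel:
`∑ ⟨K(x_i, x_j) v_j, v_i⟩ ≥ 0` for all finitely many distinct points and all vectors. -/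
def IsPositiveDefiniteKernel {X : Type*} (K : X → X → H →L[ℂ] H) : Prop :=
  ∀ (s : Finset X) (v : X → H), 0 ≤ ∑ x ∈ s, ∑ y ∈ s, inner ℂ (v x) (K x y (v y))

theorem IsPositiveDefiniteKernel.posSemidef {X : Type*} {K : X → X → H →L[ℂ] H}
    (hK : IsPositiveDefiniteKernel K) : (Matrix.of K).PosSemidef := by
  classical
  have key : ∀ (x y : X) (v w : H), inner ℂ (K y x v) w = inner ℂ v (K x y w) := by
    have diag : ∀ (x : X) (v : H), (inner ℂ v (K x x v)).im = 0 := by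
      intro x v
      have h := hK {x} fun _ => v
      simp only [Finset.sum_singleton] at h
      exact (Complex.le_def.1 h).2.symm
    have im0 : ∀ (x y : X) (v w : H),
        (inner ℂ v (K x y w)).im + (inner ℂ w (K y x v)).im = 0 := by
      intro x y v w
      by_cases hxy : x = y
      · subst hxy
        have h := diag x (v + w)
        simp only [map_add, inner_add_left, inner_add_right, Complex.add_im, diag x v,
          diag x w] at h
        linarith
      · have h := hK {x, y} fun z => if z = x then v else w
        simp only [Finset.sum_pair hxy, if_true, if_neg (Ne.symm hxy)] at h
        have h2 := (Complex.le_def.1 h).2.symm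
        simp only [Complex.add_im, diag x v, diag y w, Complex.zero_im] at h2
        linarith
    intro x y v w
    rw [← inner_conj_symm]
    have h1 := im0 x y v w
    have h2 := im0 x y v (Complex.I • w)
    simp only [map_smul, inner_smul_left, inner_smul_right, Complex.conj_I, Complex.mul_im,
      Complex.I_re, Complex.I_im, Complex.neg_re, Complex.neg_im] at h2
    apply Complex.ext
    · simp only [Complex.conj_re]
      linarith
    · simp only [Complex.conj_im]
      linarith
  refine ((RKHS.posSemidef_tfae (K := Matrix.of K)).out 0 2 rfl rfl).2 ⟨?_, fun f => ?_⟩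
  · refine Matrix.IsHermitian.ext fun x y => ?_
    refine ContinuousLinearMap.ext fun w => ext_inner_left ℂ fun v => ?_
    rw [ContinuousLinearMap.star_eq_adjoint, ContinuousLinearMap.adjoint_inner_right]
    exact key x y v w
  · have h := (Complex.le_def.1 (hK f.support f)).1
    have e : (f.sum fun x w => f.sum fun x' w' => inner ℂ ((Matrix.of K) x' x w) w') =
        ∑ x ∈ f.support, ∑ y ∈ f.support, inner ℂ (f x) (K x y (f y)) := by
      simp only [Finsupp.sum, Matrix.of_apply]
      exact Finset.sum_congr rfl fun x _ => Finset.sum_congr rfl fun y _ => key x y (f x) (f y)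
    rw [e]
    simpa using h

/-- The reproducing kernel Hilbert space of a positive definite kernel `K`: the completion of the
span of the functions `K(·, x) v`, realized as a space of functions. -/
abbrev KernelSpace {X : Type*} (K : X → X → H →L[ℂ] H) (hK : IsPositiveDefiniteKernel K) : Type _ :=
  haveI : Fact (Matrix.of K).PosSemidef := ⟨hK.posSemidef⟩
  RKHS.OfKernel (Matrix.of K)

section Derivatives

variable {m : ℕ} {U : Set (EuclideanSpace ℝ (Fin m))}

open Classical in
/-- The operator `∂^α L(x)` for an operator valued function `L`, in the strong operator sense: the
operator `v ↦ ∂^α (L(·) v)(x)`. -/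
def strongDeriv (α : Fin m → ℕ) (L : U → H →L[ℂ] H) (x : U) : H →L[ℂ] H :=
  if h : ∃ T : H →L[ℂ] H, ∀ v : H, T v = dAlpha α (fun x' => L x' v) x then h.choose else 0

open Classical in
/-- The operator `∂^β L(y)` for an operator valued function `L`, in the weak operator sense: the
operator whose matrix coefficients are the derivatives `∂^β` at `y` of those of `L`. It coincides
with the derivative in the strong operator sense, or in operator norm, when these exist. -/
def weakDeriv (β : Fin m → ℕ) (L : U → H →L[ℂ] H) (y : U) : H →L[ℂ] H :=
  if h : ∃ T : H →L[ℂ] H, ∀ u v : H, inner ℂ u (T v) = dAlpha β (fun y' => inner ℂ u (L y' v)) y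
  then h.choose else 0

/-- The operator `∂₂^β K(x, y)`. -/
def deriv₂ (K : U → U → H →L[ℂ] H) (β : Fin m → ℕ) (x y : U) : H →L[ℂ] H :=
  weakDeriv β (fun y' => K x y') y

/-- The operator `∂₁^α K(x, y)`. -/
def deriv₁ (K : U → U → H →L[ℂ] H) (α : Fin m → ℕ) (x y : U) : H →L[ℂ] H :=
  strongDeriv α (fun x' => K x' y) x

/-- The operator `∂₁^α [∂₂^β K(x, y)]`. -/
def deriv₁₂ (K : U → U → H →L[ℂ] H) (α β : Fin m → ℕ) (x y : U) : H →L[ℂ] H :=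
  deriv₁ (fun x' y' => deriv₂ K β x' y') α x y

/-- The derivatives `∂₁^α [∂₂^β K(x, y)]`, `|α|, |β| ≤ q`, exist as bounded operators, and the
functions `x ↦ ∂₂^β K(x, y) v` have the property `C` (which is `C^q` or `C^q_0`). -/
def HasKernelDerivatives (q : ℕ) (K : U → U → H →L[ℂ] H) (C : (U → H) → Prop) : Prop :=
  (∀ (x : U) (u v : H), IsCq q fun y => inner ℂ u (K x y v)) ∧
  (∀ (β : MultiIndex m q) (x y : U) (u v : H),
    inner ℂ u (deriv₂ K β.1 x y v) = dAlpha β.1 (fun y' => inner ℂ u (K x y' v)) y) ∧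
  (∀ (β : MultiIndex m q) (y : U) (v : H), C fun x => deriv₂ K β.1 x y v) ∧
  (∀ (α β : MultiIndex m q) (x y : U) (v : H),
    deriv₁₂ K α.1 β.1 x y v = dAlpha α.1 (fun x' => deriv₂ K β.1 x' y v) x) ∧
  ∀ (α : MultiIndex m q) (x y : U), deriv₁₂ K α.1 0 x y = deriv₁ K α.1 x y

/-! ### Kernel potentials of families of measures -/

section Potential

/- A family `η = (η_α)` of measures lives on a space `Z`, which is `U` itself or a compact subset
of `U`; `ι` is the inclusion of `Z` in `U`. -/
variable {Z : Type*} [MeasurableSpace Z] {q : ℕ}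

/-- `K_η(y) = ∑_α ∫ ∂₁^α K(x, y) dη_α(x)`. -/
def kernelPotential (K : U → U → H →L[ℂ] H) (ι : Z → U)
    (η : MultiIndex m q → VectorMeasure Z H) : U → H :=
  fun y => ∑ α, weakBochnerIntegral (fun x => deriv₁ K α.1 (ι x) y) (η α)

/-- `∫ ∂₁^α [∂₂^β K(x, y)] dη_α(x)`. -/
def potentialTerm (K : U → U → H →L[ℂ] H) (ι : Z → U)
    (η : MultiIndex m q → VectorMeasure Z H) (α β : MultiIndex m q) (y : U) : H :=
  weakBochnerIntegral (fun x => deriv₁₂ K α.1 β.1 (ι x) y) (η α)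

/-- The function `K_η` is the element `k` of the Hilbert space of `K`; all the integrals in its
definition exist. -/
def IsPotential (K : U → U → H →L[ℂ] H) (hK : IsPositiveDefiniteKernel K) (ι : Z → U)
    (η : MultiIndex m q → VectorMeasure Z H) (k : KernelSpace K hK) : Prop :=
  (∀ (α : MultiIndex m q) (y : U),
    WeakBochnerIntegrable (fun x => deriv₁ K α.1 (ι x) y) (η α)) ∧
  (k : U → H) = kernelPotential K ι η

/-- For all `|β| ≤ q`, `∂^β K_η(y) = ∑_α ∫ ∂₁^α [∂₂^β K(x, y)] dη_α(x)`. -/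
def DerivativeFormula (K : U → U → H →L[ℂ] H) (ι : Z → U)
    (η : MultiIndex m q → VectorMeasure Z H) : Prop :=
  ∀ (β : MultiIndex m q) (y : U),
    (∀ α : MultiIndex m q,
      WeakBochnerIntegrable (fun x => deriv₁₂ K α.1 β.1 (ι x) y) (η α)) ∧
    dAlpha β.1 (kernelPotential K ι η) y = ∑ α, potentialTerm K ι η α β y

/-- `N = ∑_{α, β} ∫ ⟨∫ ∂₁^α [∂₂^β K(x, y)] dη_α(x), dη_β(y)⟩`. -/
def DoubleIntegralFormula (K : U → U → H →L[ℂ] H) (ι : Z → U)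
    (η : MultiIndex m q → VectorMeasure Z H) (N : ℂ) : Prop :=
  (∀ α β : MultiIndex m q,
    Integrable (fun y => potentialTerm K ι η α β (ι y)) (η β).variation) ∧
  N = ∑ α, ∑ β, bartleIntegral (fun y => potentialTerm K ι η α β (ι y)) (η β)

/-- If `dη_α = h_α dμ` for a finite measure `μ` and Bochner integrable functions `h_α`, then
`N = ∑_{α, β} ∫ ∫ ⟨∂₁^α [∂₂^β K(x, y)] h_β(y), h_α(x)⟩ dμ(x) dμ(y)`. -/
def DensityFormula (K : U → U → H →L[ℂ] H) (ι : Z → U)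
    (η : MultiIndex m q → VectorMeasure Z H) (N : ℂ) : Prop :=
  ∀ (μ : Measure Z) (h : MultiIndex m q → Z → H), IsFiniteMeasure μ →
    (∀ α, Integrable (h α) μ) →
    (∀ α, ∀ s : Set Z, MeasurableSet s → η α s = ∫ z in s, h α z ∂μ) →
    (∀ (α β : MultiIndex m q) (y : Z),
      Integrable (fun x => inner ℂ (h α x) (deriv₁₂ K α.1 β.1 (ι x) (ι y) (h β y))) μ) ∧
    (∀ α β : MultiIndex m q, Integrable
      (fun y => ∫ x, inner ℂ (h α x) (deriv₁₂ K α.1 β.1 (ι x) (ι y) (h β y)) ∂μ) μ) ∧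
    N = ∑ α, ∑ β, ∫ y, ∫ x,
      inner ℂ (h α x) (deriv₁₂ K α.1 β.1 (ι x) (ι y) (h β y)) ∂μ ∂μ

end Potential

/-! ### Universality -/

/-- `C^q`-universality. -/
def IsCqUniversal (q : ℕ) (K : U → U → H →L[ℂ] H) (hK : IsPositiveDefiniteKernel K) : Prop :=
  (∀ F : KernelSpace K hK, IsCq q (F : U → H)) ∧
  ∀ A : Set U, IsCompact A → ∀ g : U → H, IsCq q g → ∀ ε > (0 : ℝ),
    ∃ f : KernelSpace K hK, ∀ x ∈ A,
      ∑ α : MultiIndex m q, ‖dAlpha α.1 (f : U → H) x - dAlpha α.1 g x‖ < ε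

/-- `C^q_0`-universality. -/
def IsC0qUniversal (q : ℕ) (K : U → U → H →L[ℂ] H) (hK : IsPositiveDefiniteKernel K) : Prop :=
  (∀ F : KernelSpace K hK, IsC0q q (F : U → H)) ∧
  ∀ g : U → H, IsC0q q g → ∀ ε > (0 : ℝ),
    ∃ f : KernelSpace K hK, ∀ x : U,
      ∑ α : MultiIndex m q, ‖dAlpha α.1 (f : U → H) x - dAlpha α.1 g x‖ < ε

end Derivatives

end

/-!
For `x : U`, let `E x : H_K → H` be the evaluation at `x`, so that `K x y = E x ∘ (E y)†`. By the
Banach–Steinhaus theorem the derivatives `D α x : f ↦ ∂^α f x` are bounded operators as well, and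
differentiating the factorization gives `∂₁^α ∂₂^β K x y = D α x ∘ (D β y)†`.

The functional `f ↦ ∑_α ∫ ⟨∂^α f, dη_α⟩` on `H_K` is continuous by the closed graph theorem. The
vector `k` that represents it satisfies `∂^β k y = D β y k`, and by the factorization this is
`∑_α ∫ ∂₁^α ∂₂^β K(·, y) dη_α`: thus `k = K_η`, and the formulas for `⟨K_η, K_η⟩` are the values of
the functional at `k`, computed in two ways.

Since `⟨K_η, K_η⟩ = 0` means that the functional of `η` vanishes on `H_K`, universality follows
from the Hahn–Banach theorem and the representation of the dual of `C₀(Z, H)` by vector measures.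
For the latter, the total variation of a functional `L` is a positive functional on `C_c(Z)`,
hence given by a finite measure `μ` with `‖L F‖ ≤ ∫ ‖F‖ dμ`, and so `L` extends to `L²(μ, H)` and
is represented by a density there.
-/

section LineDerivatives

variable {X V V' : Type*} [NormedAddCommGroup X] [NormedSpace ℝ X]
  [NormedAddCommGroup V] [NormedSpace ℝ V] [NormedAddCommGroup V'] [NormedSpace ℝ V']

theorem lineDeriv_clm_comp {f : X → V} {x v : X} (h : LineDifferentiableAt ℝ f x v)
    (L : V →L[ℝ] V') : lineDeriv ℝ (L ∘ f) x v = L (lineDeriv ℝ f x v) := by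
  have hf : HasDerivAt (fun t : ℝ => f (x + t • v)) (lineDeriv ℝ f x v) 0 := h.hasLineDerivAt
  exact HasLineDerivAt.lineDeriv (L.hasFDerivAt.comp_hasDerivAt 0 hf)

theorem exists_clm_lineDeriv {W F : Type*} [NormedAddCommGroup W] [NormedSpace ℂ W]
    [CompleteSpace W] [NormedAddCommGroup F] [NormedSpace ℂ F] {E : X → W →L[ℂ] F} {x v : X}
    (h : ∀ w, LineDifferentiableAt ℝ (fun y => E y w) x v) :
    ∃ D : W →L[ℂ] F, ∀ w, D w = lineDeriv ℝ (fun y => E y w) x v := by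
  -- A pointwise limit of bounded operators, here the difference quotients, is bounded.
  let slope : ℝ → W →L[ℂ] F := fun t => (t : ℂ)⁻¹ • (E (x + t • v) - E x)
  have hslope : Tendsto (fun t w => slope t w) (𝓝[≠] 0)
      (𝓝 fun w => lineDeriv ℝ (fun y => E y w) x v) := by
    refine tendsto_pi_nhds.2 fun w => (h w).hasLineDerivAt.tendsto_slope_zero.congr fun t => ?_
    simp only [slope, smul_apply, sub_apply, ← Complex.ofReal_inv, Complex.coe_smul]
  exact ⟨continuousLinearMapOfTendsto slope hslope, fun _ => rfl⟩

end LineDerivatives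

section IteratedPartialDerivatives

variable {m : ℕ} {V V' : Type*} [NormedAddCommGroup V] [NormedSpace ℝ V]
  [NormedAddCommGroup V'] [NormedSpace ℝ V'] {U : Set (EuclideanSpace ℝ (Fin m))}
  {f g : EuclideanSpace ℝ (Fin m) → V}

/-- The list of coordinate directions in which `∂^α` differentiates, so that statements on `∂^α`
can be proved by induction on a list. -/
def directions (α : Fin m → ℕ) : List (Fin m) :=
  (List.finRange m).flatMap fun i => List.replicate (α i) i

theorem length_directions (α : Fin m → ℕ) : (directions α).length = ∑ i, α i := by
  simp [directions, List.length_flatMap, Fin.sum_univ_def]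

theorem foldr_replicate_eq_iterate {ι β : Type*} (φ : ι → β → β) (i : ι) (n : ℕ) (b : β) :
    (List.replicate n i).foldr φ b = (φ i)^[n] b := by
  induction n with
  | zero => rfl
  | succ n ih => rw [List.replicate_succ, List.foldr_cons, ih, Function.iterate_succ_apply']

theorem iterPartial_eq_foldr (α : Fin m → ℕ) (f : EuclideanSpace ℝ (Fin m) → V) :
    iterPartial α f = (directions α).foldr partialDeriv f := by
  simp only [iterPartial, directions, List.foldr_flatMap, foldr_replicate_eq_iterate]

theorem eqOn_foldr_partialDeriv (hU : IsOpen U) (h : Set.EqOn f g U) (l : List (Fin m)) :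
    Set.EqOn (l.foldr partialDeriv f) (l.foldr partialDeriv g) U := by
  induction l with
  | nil => exact h
  | cons i l ih => exact fun x hx => (ih.eventuallyEq_of_mem (hU.mem_nhds hx)).lineDeriv_eq

theorem contDiffOn_partialDeriv (hU : IsOpen U) {n : ℕ}
    (hf : ContDiffOn ℝ ((n + 1 : ℕ) : WithTop ℕ∞) f U) (i : Fin m) :
    ContDiffOn ℝ (n : WithTop ℕ∞) (partialDeriv i f) U := by
  have hderiv : ContDiffOn ℝ (n : WithTop ℕ∞) (fderiv ℝ f) U :=
    hf.fderiv_of_isOpen hU (by norm_cast)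
  refine (hderiv.clm_apply (contDiffOn_const (c := EuclideanSpace.single i (1 : ℝ)))).congr
    fun x hx => ?_
  exact ((hf.differentiableOn (by simp)).differentiableAt (hU.mem_nhds hx)).lineDeriv_eq_fderiv

theorem contDiffOn_foldr_partialDeriv (hU : IsOpen U) {n : ℕ} (l : List (Fin m))
    (hf : ContDiffOn ℝ ((n + l.length : ℕ) : WithTop ℕ∞) f U) :
    ContDiffOn ℝ (n : WithTop ℕ∞) (l.foldr partialDeriv f) U := by
  induction l generalizing n with
  | nil => exact hf
  | cons i l ih =>
    refine contDiffOn_partialDeriv hU (ih ?_) i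
    rwa [List.length_cons, add_comm l.length, ← add_assoc] at hf

theorem lineDifferentiableAt_foldr_partialDeriv (hU : IsOpen U) (l : List (Fin m))
    (hf : ContDiffOn ℝ ((l.length + 1 : ℕ) : WithTop ℕ∞) f U) {x : EuclideanSpace ℝ (Fin m)}
    (hx : x ∈ U) (v : EuclideanSpace ℝ (Fin m)) :
    LineDifferentiableAt ℝ (l.foldr partialDeriv f) x v := by
  have h : ContDiffOn ℝ ((1 : ℕ) : WithTop ℕ∞) (l.foldr partialDeriv f) U :=
    contDiffOn_foldr_partialDeriv hU l (by rwa [add_comm 1])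
  exact ((h.differentiableOn (by simp)).differentiableAt (hU.mem_nhds hx)).lineDifferentiableAt

theorem eqOn_foldr_partialDeriv_clm_comp (hU : IsOpen U) (L : V →L[ℝ] V') (l : List (Fin m))
    (hf : ContDiffOn ℝ (l.length : WithTop ℕ∞) f U) :
    Set.EqOn (l.foldr partialDeriv (L ∘ f)) (L ∘ l.foldr partialDeriv f) U := by
  induction l with
  | nil => exact fun _ _ => rfl
  | cons i l ih =>
    intro x hx
    have hl := ih (hf.of_le (by simp))
    exact (hl.eventuallyEq_of_mem (hU.mem_nhds hx)).lineDeriv_eq.trans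
      (lineDeriv_clm_comp (lineDifferentiableAt_foldr_partialDeriv hU l hf hx _) L)

theorem exists_clm_foldr_partialDeriv {W F : Type*} [NormedAddCommGroup W] [NormedSpace ℂ W]
    [CompleteSpace W] [NormedAddCommGroup F] [NormedSpace ℂ F] (hU : IsOpen U)
    {E : EuclideanSpace ℝ (Fin m) → W →L[ℂ] F} (l : List (Fin m))
    (hE : ∀ w, ContDiffOn ℝ (l.length : WithTop ℕ∞) (fun x => E x w) U) :
    ∃ D : EuclideanSpace ℝ (Fin m) → W →L[ℂ] F,
      ∀ w, Set.EqOn (l.foldr partialDeriv fun x => E x w) (fun x => D x w) U := by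
  induction l with
  | nil => exact ⟨E, fun _ _ _ => rfl⟩
  | cons i l ih =>
    obtain ⟨D, hD⟩ := ih fun w => (hE w).of_le (by simp)
    have hDl : ∀ x ∈ U, ∀ w, (l.foldr partialDeriv fun y => E y w) =ᶠ[𝓝 x] fun y => D y w :=
      fun x hx w => (hD w).eventuallyEq_of_mem (hU.mem_nhds hx)
    have hDi : ∀ x ∈ U, ∃ D' : W →L[ℂ] F, ∀ w, D' w = partialDeriv i (fun y => D y w) x :=
      fun x hx => exists_clm_lineDeriv fun w => ((hDl x hx w).lineDifferentiableAt_iff).1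
        (lineDifferentiableAt_foldr_partialDeriv hU l (hE w) hx _)
    choose! D' hD' using hDi
    exact ⟨D', fun w x hx => (hDl x hx w).lineDeriv_eq.trans (hD' x hx w).symm⟩

end IteratedPartialDerivatives

section OpenSets

variable {m q : ℕ} {U : Set (EuclideanSpace ℝ (Fin m))}

theorem extendZero_apply {V : Type*} [NormedAddCommGroup V] (F : U → V) (x : U) :
    extendZero F x = F x :=
  Subtype.val_injective.extend_apply F 0 x

theorem extendZero_comp {V V' : Type*} [NormedAddCommGroup V] [NormedAddCommGroup V'] {φ : V → V'}
    (hφ : φ 0 = 0) (F : U → V) : extendZero (fun x => φ (F x)) = φ ∘ extendZero F := by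
  funext x
  rw [Function.comp_apply, extendZero, extendZero, Function.apply_extend φ]
  congr 1
  exact funext fun _ => hφ.symm

variable {V V' : Type*} [NormedAddCommGroup V] [NormedSpace ℝ V]
  [NormedAddCommGroup V'] [NormedSpace ℝ V']

theorem length_directions_le (α : MultiIndex m q) : (directions α.1).length ≤ q :=
  (length_directions α.1).trans_le (mem_multiIndices.1 α.2)

@[simp]
theorem dAlpha_zero (F : U → V) : dAlpha 0 F = F := by
  have hdirections : directions (0 : Fin m → ℕ) = [] :=
    List.eq_nil_of_length_eq_zero (by simp [length_directions])
  funext x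
  rw [dAlpha, iterPartial_eq_foldr, hdirections, List.foldr_nil, extendZero_apply]

theorem IsCq.contDiffOn_length_directions {F : U → V} (hF : IsCq q F) (α : MultiIndex m q) :
    ContDiffOn ℝ ((directions α.1).length : WithTop ℕ∞) (extendZero F) U :=
  hF.of_le (by exact_mod_cast length_directions_le α)

theorem IsCq.continuous_dAlpha (hU : IsOpen U) {F : U → V} (hF : IsCq q F) (α : MultiIndex m q) :
    Continuous (dAlpha α.1 F) := by
  have h : ContDiffOn ℝ ((0 : ℕ) : WithTop ℕ∞) (iterPartial α.1 (extendZero F)) U := by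
    rw [iterPartial_eq_foldr]
    exact contDiffOn_foldr_partialDeriv hU _ (by simpa using hF.contDiffOn_length_directions α)
  exact continuousOn_iff_continuous_domRestrict.1 h.continuousOn

theorem IsCq.clm_comp {F : U → V} (hF : IsCq q F) (L : V →L[ℝ] V') :
    IsCq q fun x => L (F x) := by
  rw [IsCq, extendZero_comp L.map_zero]
  exact L.contDiff.comp_contDiffOn hF

theorem IsCq.dAlpha_clm_comp (hU : IsOpen U) {F : U → V} (hF : IsCq q F) (L : V →L[ℝ] V')
    (α : MultiIndex m q) (x : U) : dAlpha α.1 (fun x => L (F x)) x = L (dAlpha α.1 F x) := by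
  rw [dAlpha, extendZero_comp L.map_zero, dAlpha, iterPartial_eq_foldr, iterPartial_eq_foldr]
  exact eqOn_foldr_partialDeriv_clm_comp hU L _ (hF.contDiffOn_length_directions α) x.2

end OpenSets

/-- `E x w` is the value at `x` of a `C^q` function on `U` represented by the vector `w`, and
`D α x` is the bounded operator `w ↦ ∂^α (E · w)(x)`. -/
structure HasStrongDerivs {m q : ℕ} {U : Set (EuclideanSpace ℝ (Fin m))} {V W : Type*}
    [NormedAddCommGroup V] [NormedSpace ℂ V] [NormedAddCommGroup W] [NormedSpace ℂ W]
    (E : U → W →L[ℂ] V) (D : MultiIndex m q → U → W →L[ℂ] V) : Prop where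
  isCq : ∀ w, IsCq q fun x => E x w
  dAlpha_eq : ∀ α w, dAlpha α.1 (fun x => E x w) = fun x => D α x w

namespace HasStrongDerivs

variable {m q : ℕ} {U : Set (EuclideanSpace ℝ (Fin m))} {V W : Type*}
  [NormedAddCommGroup V] [NormedSpace ℂ V] [NormedAddCommGroup W] [NormedSpace ℂ W]
  {E : U → W →L[ℂ] V}

theorem exists_of_isCq [CompleteSpace W] (hU : IsOpen U) (hE : ∀ w, IsCq q fun x => E x w) :
    ∃ D : MultiIndex m q → U → W →L[ℂ] V, HasStrongDerivs E D := by
  have hext : ∀ w, extendZero (fun x => E x w) = fun y => extendZero E y w := fun w =>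
    extendZero_comp (φ := fun T : W →L[ℂ] V => T w) rfl E
  have hD : ∀ α : MultiIndex m q, ∃ D : EuclideanSpace ℝ (Fin m) → W →L[ℂ] V, ∀ w,
      Set.EqOn ((directions α.1).foldr partialDeriv fun y => extendZero E y w)
        (fun x => D x w) U := fun α =>
    exists_clm_foldr_partialDeriv hU _ fun w => hext w ▸ (hE w).contDiffOn_length_directions α
  choose D hD using hD
  refine ⟨fun α x => D α x, hE, fun α w => funext fun x => ?_⟩
  rw [dAlpha, hext, iterPartial_eq_foldr]
  exact hD α w x.2

variable {D : MultiIndex m q → U → W →L[ℂ] V}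

theorem continuous_apply (h : HasStrongDerivs E D) (hU : IsOpen U) (α : MultiIndex m q) (w : W) :
    Continuous fun x => D α x w :=
  h.dAlpha_eq α w ▸ (h.isCq w).continuous_dAlpha hU α

theorem zeroIndex_eq (h : HasStrongDerivs E D) : D (zeroIndex m q) = E := by
  ext x w
  exact (congrFun (h.dAlpha_eq (zeroIndex m q) w) x).symm.trans (congrFun (dAlpha_zero _) x)

end HasStrongDerivs

section Integrals

variable {H : Type*} [NormedAddCommGroup H] [InnerProductSpace ℂ H]
  {Z : Type*} [MeasurableSpace Z] {η : VectorMeasure Z H} {f g : Z → H}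

theorem norm_pairing_le : ‖pairing H‖ ≤ 1 :=
  LinearMap.mkContinuous₂_norm_le _ zero_le_one _

theorem bartleIntegral_add (hf : Integrable f η.variation) (hg : Integrable g η.variation) :
    bartleIntegral (f + g) η = bartleIntegral f η + bartleIntegral g η :=
  VectorMeasure.integral_add hf hg

theorem bartleIntegral_smul (c : ℂ) (f : Z → H) :
    bartleIntegral (c • f) η = c * bartleIntegral f η :=
  setToFun_smul _ (fun c _ x => inner_smul_right (𝕜 := ℂ) _ x c) c f

theorem bartleIntegral_indicator_const (v : H) {s : Set Z} (hs : MeasurableSet s)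
    (hηs : η.variation s ≠ ⊤) :
    bartleIntegral (s.indicator fun _ => v) η = inner ℂ (η s) v :=
  setToFun_indicator_const _ hs hηs v

theorem bartleIntegral_congr_ae (h : f =ᵐ[η.variation] g) :
    bartleIntegral f η = bartleIntegral g η :=
  VectorMeasure.integral_congr_ae h

theorem norm_bartleIntegral_le [IsFiniteMeasure η.variation] {C : ℝ} (hC : 0 ≤ C)
    (hf : ∀ z, ‖f z‖ ≤ C) : ‖bartleIntegral f η‖ ≤ C * η.variation.real Set.univ := by
  refine (VectorMeasure.norm_integral_le_of_norm_le_const (Eventually.of_forall hf)).trans ?_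
  exact mul_le_mul_of_nonneg_right (mul_le_of_le_one_right hC norm_pairing_le) measureReal_nonneg

end Integrals

section Densities

variable {H : Type*} [NormedAddCommGroup H] [InnerProductSpace ℂ H] [CompleteSpace H]
  {Z : Type*} [MeasurableSpace Z] {μ : Measure Z} {h f : Z → H}

theorem integrable_variation_withDensityᵥ_iff (hh : Integrable h μ) :
    Integrable f (μ.withDensityᵥ h).variation ↔ Integrable (fun z => ‖h z‖ • f z) μ := by
  rw [Measure.variation_withDensityᵥ hh]
  exact integrable_withDensity_iff_integrable_smul₀ hh.aestronglyMeasurable.nnnorm.aemeasurable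

theorem integral_norm_variation_withDensityᵥ (hh : Integrable h μ) :
    ∫ z, ‖f z‖ ∂(μ.withDensityᵥ h).variation = ∫ z, ‖h z‖ * ‖f z‖ ∂μ := by
  rw [Measure.variation_withDensityᵥ hh]
  exact integral_withDensity_eq_integral_smul₀
    hh.aestronglyMeasurable.nnnorm.aemeasurable fun z => ‖f z‖

theorem integrable_inner_of_variation_withDensityᵥ (hh : Integrable h μ)
    (hf : Integrable f (μ.withDensityᵥ h).variation) :
    Integrable (fun z => inner ℂ (h z) (f z)) μ := by
  have hhf := (integrable_variation_withDensityᵥ_iff hh).1 hf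
  -- `f` itself need not be measurable where `h` vanishes.
  have hinner : ∀ z, ‖h z‖⁻¹ • inner ℂ (h z) (‖h z‖ • f z) = inner ℂ (h z) (f z) := by
    intro z
    rcases eq_or_ne (h z) 0 with hz | hz
    · simp only [hz, inner_zero_left, smul_zero]
    · rw [inner_smul_right_eq_smul, inv_smul_smul₀ (norm_ne_zero_iff.2 hz)]
  refine hhf.mono ?_ (Eventually.of_forall fun z => ?_)
  · exact ((hh.aestronglyMeasurable.norm.inv₀).smul
      (hh.aestronglyMeasurable.inner hhf.aestronglyMeasurable)).congr (Eventually.of_forall hinner)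
  · rw [norm_smul, norm_norm]
    exact norm_inner_le_norm _ _

theorem integral_inner_congr_variation (hh : Integrable h μ) {g : Z → H}
    (hfg : f =ᵐ[(μ.withDensityᵥ h).variation] g) :
    ∫ z, inner ℂ (h z) (f z) ∂μ = ∫ z, inner ℂ (h z) (g z) ∂μ := by
  rw [Measure.variation_withDensityᵥ hh, EventuallyEq,
    ae_withDensity_iff' hh.aestronglyMeasurable.enorm] at hfg
  refine integral_congr_ae (hfg.mono fun z hz => ?_)
  rcases eq_or_ne (h z) 0 with hz0 | hz0
  · simp only [hz0, inner_zero_left]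
  · exact congrArg (inner ℂ (h z)) (hz (enorm_ne_zero.2 hz0))

theorem continuous_integral_inner_L1 (hh : Integrable h μ) :
    Continuous fun F : Z →₁[(μ.withDensityᵥ h).variation] H => ∫ z, inner ℂ (h z) (F z) ∂μ := by
  have hint := fun F : Z →₁[(μ.withDensityᵥ h).variation] H =>
    integrable_inner_of_variation_withDensityᵥ hh (L1.integrable_coeFn F)
  refine LipschitzWith.continuous (K := 1) (LipschitzWith.of_dist_le_mul fun F G => ?_)
  have hFG := (integrable_variation_withDensityᵥ_iff hh).1
    ((L1.integrable_coeFn F).sub (L1.integrable_coeFn G))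
  rw [dist_eq_norm, ← integral_sub (hint F) (hint G), NNReal.coe_one, one_mul,
    L1.dist_eq_integral_dist]
  simp only [dist_eq_norm, ← inner_sub_right]
  rw [integral_norm_variation_withDensityᵥ (f := fun z => F z - G z) hh]
  have hdom : Integrable (fun z => ‖h z‖ * ‖F z - G z‖) μ := by
    simpa only [norm_smul, norm_norm, Pi.sub_apply] using hFG.norm
  exact norm_integral_le_of_norm_le hdom (Eventually.of_forall fun z => norm_inner_le_norm _ _)

theorem bartleIntegral_withDensityᵥ (hh : Integrable h μ)
    (hf : Integrable f (μ.withDensityᵥ h).variation) :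
    bartleIntegral f (μ.withDensityᵥ h) = ∫ z, inner ℂ (h z) (f z) ∂μ := by
  refine hf.induction (P := fun f => bartleIntegral f (μ.withDensityᵥ h) =
    ∫ z, inner ℂ (h z) (f z) ∂μ) ?indicator ?add ?closed ?congr
  case indicator =>
    intro v s hs hμs
    have hind : (fun z => inner ℂ (h z) (s.indicator (fun _ => v) z)) =
        s.indicator fun z => inner ℂ (h z) v := by
      funext z
      by_cases hz : z ∈ s <;> simp [hz]
    rw [bartleIntegral_indicator_const v hs hμs.ne, withDensityᵥ_apply hh hs, hind,
      integral_indicator hs, ← inner_conj_symm, ← integral_inner hh.integrableOn v,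
      ← integral_conj]
    simp only [inner_conj_symm]
  case add =>
    intro f g _ hf hg ihf ihg
    rw [bartleIntegral_add hf hg, ihf, ihg, ← integral_add
      (integrable_inner_of_variation_withDensityᵥ hh hf)
      (integrable_inner_of_variation_withDensityᵥ hh hg)]
    simp only [Pi.add_apply, inner_add_right]
  case closed =>
    exact isClosed_eq VectorMeasure.continuous_integral (continuous_integral_inner_L1 hh)
  case congr =>
    intro f g hfg _ ih
    rw [← bartleIntegral_congr_ae hfg, ih, integral_inner_congr_variation hh hfg]

end Densities

section WeakIntegrals

variable {W V Z : Type*} [NormedAddCommGroup W] [CompleteSpace W] [MeasurableSpace Z]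

theorem continuous_toL1_clm_apply [NormedSpace ℂ W] [NormedAddCommGroup V] [NormedSpace ℂ V]
    [CompleteSpace V] {ν : Measure Z} {T : Z → W →L[ℂ] V}
    (hT : ∀ w, Integrable (fun z => T z w) ν) : Continuous fun w => (hT w).toL1 := by
  let Φ : W →ₗ[ℂ] (Z →₁[ν] V) :=
    { toFun := fun w => (hT w).toL1
      map_add' := fun w w' => by simp only [map_add]; exact Integrable.toL1_add _ _ (hT w) (hT w')
      map_smul' := fun c w => by simp only [map_smul]; exact Integrable.toL1_smul' _ (hT w) c }
  refine Φ.continuous_of_seq_closed_graph fun u w F hu hF => ?_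
  obtain ⟨ns, hns, hlim⟩ := (tendstoInMeasure_of_tendsto_Lp hF).exists_seq_tendsto_ae
  refine Lp.ext ?_
  filter_upwards [hlim, (hT w).coeFn_toL1, ae_all_iff.2 fun n => (hT (u (ns n))).coeFn_toL1]
    with z hz hw hun
  refine (tendsto_nhds_unique hz ?_).trans hw.symm
  exact ((((T z).continuous.tendsto w).comp hu).comp hns.tendsto_atTop).congr
    fun n => (hun n).symm

variable {H : Type*} [NormedAddCommGroup H] [InnerProductSpace ℂ H] [InnerProductSpace ℂ W]
  {η : VectorMeasure Z H}

/-- `w = ∫ T dη` in the weak sense, for operators `T z` defined on a Hilbert space `W` that may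
differ from the one in which `η` takes its values. -/
def IsWeakIntegral (T : Z → W →L[ℂ] H) (η : VectorMeasure Z H) (w : W) : Prop :=
  ∀ f : W, inner ℂ w f = bartleIntegral (fun z => T z f) η

theorem IsWeakIntegral.exists_of_integrable [CompleteSpace H] {T : Z → W →L[ℂ] H}
    (hT : ∀ f, Integrable (fun z => T z f) η.variation) : ∃ w, IsWeakIntegral T η w := by
  let ℓ : W →ₗ[ℂ] ℂ :=
    { toFun := fun f => bartleIntegral (fun z => T z f) η
      map_add' := fun f g => by
        simp only [map_add]
        exact bartleIntegral_add (hT f) (hT g)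
      map_smul' := fun c f => by
        simp only [map_smul]
        exact bartleIntegral_smul c _ }
  have hℓ : Continuous ℓ := (VectorMeasure.continuous_integral.comp
    (continuous_toL1_clm_apply hT)).congr fun f => bartleIntegral_congr_ae (hT f).coeFn_toL1
  exact ⟨(InnerProductSpace.toDual ℂ W).symm ⟨ℓ, hℓ⟩,
    fun f => InnerProductSpace.toDual_symm_apply⟩

theorem IsWeakIntegral.comp_adjoint {W' : Type*} [NormedAddCommGroup W'] [InnerProductSpace ℂ W']
    [CompleteSpace W'] {T : Z → W →L[ℂ] H} {w : W} (h : IsWeakIntegral T η w) (S : W →L[ℂ] W') :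
    IsWeakIntegral (fun z => T z ∘L S.adjoint) η (S w) := fun f =>
  (S.adjoint_inner_right w f).symm.trans (h (S.adjoint f))

theorem IsWeakIntegral.weakBochnerIntegral_eq {T : Z → H →L[ℂ] H} {w : H}
    (h : IsWeakIntegral T η w) : weakBochnerIntegral T η = w := by
  have hex : ∃ w : H, ∀ v : H, inner ℂ w v = bartleIntegral (fun z => T z v) η := ⟨w, h⟩
  rw [weakBochnerIntegral, dif_pos hex]
  exact ext_inner_right ℂ fun v => (hex.choose_spec v).trans (h v).symm

theorem IsWeakIntegral.weakBochnerIntegrable {T : Z → H →L[ℂ] H} {w : H}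
    (h : IsWeakIntegral T η w) (hT : ∀ v, Integrable (fun z => T z v) η.variation) :
    WeakBochnerIntegrable T η :=
  ⟨hT, (innerSL ℂ w).continuous.congr h⟩

end WeakIntegrals

section Riesz

open scoped ZeroAtInfty CompactlySupported NNReal ENNReal

variable {Z : Type*} [TopologicalSpace Z] {E : Type*} [NormedAddCommGroup E]

theorem norm_zeroAtInfty_le_iff {F : C₀(Z, E)} {C : ℝ} (hC : 0 ≤ C) :
    ‖F‖ ≤ C ↔ ∀ x, ‖F x‖ ≤ C := by
  rw [← ZeroAtInftyContinuousMap.norm_toBCF_eq_norm]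
  exact BoundedContinuousFunction.norm_le hC

theorem norm_zeroAtInfty_apply_le (F : C₀(Z, E)) (x : Z) : ‖F x‖ ≤ ‖F‖ :=
  (norm_zeroAtInfty_le_iff (norm_nonneg F)).1 le_rfl x

section DualMeasure

variable [NormedSpace ℂ E]

theorem norm_div_smul_le {a b : ℝ≥0} (hab : a ≤ b) (v : E) : ‖(a / b) • v‖ ≤ ‖v‖ := by
  rw [NNReal.smul_def, norm_smul, NNReal.norm_eq]
  exact mul_le_of_le_one_left (norm_nonneg v) (NNReal.coe_le_one.2 (div_le_one_of_le₀ hab zero_le))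

theorem continuous_div_smul {F : Z → E} (hF : Continuous F) {a b : Z → ℝ≥0} (ha : Continuous a)
    (hb : Continuous b) (hab : ∀ x, a x ≤ b x) (hFb : ∀ x, ‖F x‖₊ ≤ b x) :
    Continuous fun x => (a x / b x) • F x := by
  refine continuous_iff_continuousAt.2 fun x => ?_
  rcases eq_or_ne (F x) 0 with hx | hx
  · rw [ContinuousAt, hx, smul_zero]
    exact squeeze_zero_norm (fun y => norm_div_smul_le (hab y) (F y))
      (tendsto_zero_iff_norm_tendsto_zero.1 (hx ▸ hF.tendsto x))
  · have hbx : b x ≠ 0 := ((nnnorm_pos.2 hx).trans_le (hFb x)).ne'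
    exact (ha.continuousAt.div₀ hb.continuousAt hbx).smul hF.continuousAt

theorem exists_zeroAtInfty_div_smul (F : C₀(Z, E)) {a b : Z → ℝ≥0} (ha : Continuous a)
    (hb : Continuous b) (hab : ∀ x, a x ≤ b x) (hFb : ∀ x, ‖F x‖₊ ≤ b x) :
    ∃ G : C₀(Z, E), (∀ x, G x = (a x / b x) • F x) ∧ ∀ x, ‖G x‖₊ ≤ a x := by
  refine ⟨⟨⟨_, continuous_div_smul F.continuous ha hb hab hFb⟩, ?_⟩, fun x => rfl, fun x => ?_⟩
  · exact squeeze_zero_norm (fun x => norm_div_smul_le (hab x) (F x))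
      (tendsto_zero_iff_norm_tendsto_zero.1 F.zero_at_infty')
  · change ‖(a x / b x) • F x‖₊ ≤ a x
    rw [NNReal.smul_def, nnnorm_smul, NNReal.nnnorm_eq]
    calc a x / b x * ‖F x‖₊ ≤ a x / b x * b x := mul_le_mul_right (hFb x) _
      _ = a x * b x / b x := div_mul_eq_mul_div _ _ _
      _ ≤ a x := div_le_of_le_mul₀ zero_le zero_le le_rfl

theorem exists_add_eq_of_nnnorm_le_add {F : C₀(Z, E)} {f g : Z → ℝ≥0} (hf : Continuous f)
    (hg : Continuous g) (hF : ∀ x, ‖F x‖₊ ≤ f x + g x) :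
    ∃ F₁ F₂ : C₀(Z, E), F₁ + F₂ = F ∧ (∀ x, ‖F₁ x‖₊ ≤ f x) ∧ ∀ x, ‖F₂ x‖₊ ≤ g x := by
  obtain ⟨F₁, h₁, hF₁⟩ :=
    exists_zeroAtInfty_div_smul F hf (hf.add hg) (fun _ => le_self_add) hF
  obtain ⟨F₂, h₂, hF₂⟩ :=
    exists_zeroAtInfty_div_smul F hg (hf.add hg) (fun _ => le_add_self) hF
  refine ⟨F₁, F₂, ZeroAtInftyContinuousMap.ext fun x => ?_, hF₁, hF₂⟩
  rw [ZeroAtInftyContinuousMap.add_apply, h₁, h₂, ← add_smul, ← add_div]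
  rcases eq_or_ne (f x + g x) 0 with hx | hx
  · rw [nnnorm_eq_zero.1 (le_zero_iff.1 ((hF x).trans hx.le)), smul_zero]
  · exact (congrArg (· • F x) (div_self hx)).trans (one_smul _ _)

theorem exists_norm_sub_le_nnnorm_le_compactlySupported [R1Space Z] (F : C₀(Z, E)) {ε : ℝ≥0}
    (hε : 0 < ε) :
    ∃ (G : C₀(Z, E)) (g : C_c(Z, ℝ≥0)),
      ‖F - G‖ ≤ ε ∧ (∀ x, ‖G x‖₊ ≤ g x) ∧ ∀ x, g x ≤ ‖F x‖₊ := by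
  have hn : Continuous fun x => ‖F x‖₊ := F.continuous.nnnorm
  let g : C_c(Z, ℝ≥0) := ⟨⟨fun x => ‖F x‖₊ - ε, hn.sub continuous_const⟩, by
    have hF0 : Tendsto (fun x => ‖F x‖) (cocompact Z) (𝓝 0) :=
      tendsto_zero_iff_norm_tendsto_zero.1 F.zero_at_infty'
    obtain ⟨C, hC, hCF⟩ := mem_cocompact.1 (hF0.eventually_lt_const (NNReal.coe_pos.2 hε))
    exact HasCompactSupport.intro hC fun x hx => tsub_eq_zero_of_le (le_of_lt (hCF hx))⟩
  have hgF : ∀ x, g x ≤ ‖F x‖₊ := fun x => tsub_le_self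
  obtain ⟨G, hG, hGg⟩ :=
    exists_zeroAtInfty_div_smul F g.continuous hn hgF fun x => le_rfl
  refine ⟨G, g, (norm_zeroAtInfty_le_iff ε.2).2 fun x => ?_, hGg, hgF⟩
  rcases eq_or_ne (F x) 0 with hx | hx
  · rw [ZeroAtInftyContinuousMap.sub_apply, hG, hx, smul_zero, sub_zero, norm_zero]
    exact ε.2
  · have hFx : ‖F x‖ ≠ 0 := norm_ne_zero_iff.2 hx
    have hgx : ‖F x‖₊ ≤ g x + ε := le_tsub_add
    have hsub : (F - G) x = (1 - g x / ‖F x‖ : ℝ) • F x := by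
      rw [ZeroAtInftyContinuousMap.sub_apply, hG, sub_smul, one_smul]
      rfl
    have hnonneg : 0 ≤ 1 - g x / ‖F x‖ :=
      sub_nonneg.2 (div_le_one_of_le₀ (hgF x) (norm_nonneg _))
    rw [hsub, norm_smul, Real.norm_of_nonneg hnonneg, sub_mul, one_mul, div_mul_cancel₀ _ hFx]
    exact sub_le_iff_le_add'.2 hgx

/-- The total variation `f ↦ sup {|L F| : ‖F‖ ≤ f}` of a functional `L` on `C₀(Z, E)`. It is the
restriction to nonnegative functions of the positive functional given by the variation of the
measure that represents `L`. -/
noncomputable def dualVariation (L : C₀(Z, E) →L[ℂ] ℂ) (f : C_c(Z, ℝ≥0)) : ℝ≥0 :=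
  ⨆ F : {F : C₀(Z, E) // ∀ x, ‖F x‖₊ ≤ f x}, ‖L F‖₊

variable (L : C₀(Z, E) →L[ℂ] ℂ) {f g : C_c(Z, ℝ≥0)} {F G : C₀(Z, E)}

theorem dualVariation_le {c : ℝ≥0} (h : ∀ F : C₀(Z, E), (∀ x, ‖F x‖₊ ≤ f x) → ‖L F‖₊ ≤ c) :
    dualVariation L f ≤ c :=
  ciSup_le' fun F => h F F.2

theorem nnnorm_apply_le_of_forall {c : ℝ≥0} (hF : ∀ x, ‖F x‖₊ ≤ c) : ‖L F‖₊ ≤ ‖L‖₊ * c :=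
  (L.le_opNNNorm F).trans
    (mul_le_mul_right (b := ‖F‖₊) ((norm_zeroAtInfty_le_iff c.2).2 hF) ‖L‖₊)

theorem nnnorm_le_dualVariation (hF : ∀ x, ‖F x‖₊ ≤ f x) : ‖L F‖₊ ≤ dualVariation L f := by
  obtain ⟨c, hc⟩ := (f.hasCompactSupport.isCompact_range f.continuous).bddAbove
  refine le_ciSup (f := fun F : {F : C₀(Z, E) // ∀ x, ‖F x‖₊ ≤ f x} => ‖L F‖₊) ⟨‖L‖₊ * c, ?_⟩
    ⟨F, hF⟩
  rintro _ ⟨⟨G, hG⟩, rfl⟩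
  exact nnnorm_apply_le_of_forall L fun x => (hG x).trans (hc ⟨x, rfl⟩)

theorem nnnorm_add_nnnorm_le_dualVariation_add (hF : ∀ x, ‖F x‖₊ ≤ f x)
    (hG : ∀ x, ‖G x‖₊ ≤ g x) : ‖L F‖₊ + ‖L G‖₊ ≤ dualVariation L (f + g) := by
  obtain ⟨a, ha, haF⟩ := Complex.exists_norm_eq_mul_self (L F)
  obtain ⟨b, hb, hbG⟩ := Complex.exists_norm_eq_mul_self (L G)
  have hsum : L (a • F + b • G) = (‖L F‖ + ‖L G‖ : ℝ) := by
    rw [map_add, map_smul, map_smul, smul_eq_mul, smul_eq_mul, ← haF, ← hbG, Complex.ofReal_add]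
  have hle : ∀ x, ‖(a • F + b • G) x‖₊ ≤ (f + g) x := fun x => by
    refine (nnnorm_add_le _ _).trans (add_le_add ?_ ?_)
    · exact (nnnorm_smul a (F x)).trans_le
        ((mul_le_of_le_one_left (norm_nonneg _) ha.le).trans (hF x))
    · exact (nnnorm_smul b (G x)).trans_le
        ((mul_le_of_le_one_left (norm_nonneg _) hb.le).trans (hG x))
  calc ‖L F‖₊ + ‖L G‖₊ = ‖L (a • F + b • G)‖₊ := by
        rw [hsum, Complex.nnnorm_real, Real.nnnorm_of_nonneg (by positivity)]
        rfl
    _ ≤ dualVariation L (f + g) := nnnorm_le_dualVariation L hle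

theorem dualVariation_add_le :
    dualVariation L (f + g) ≤ dualVariation L f + dualVariation L g := by
  refine dualVariation_le L fun F hF => ?_
  obtain ⟨F₁, F₂, rfl, h₁, h₂⟩ := exists_add_eq_of_nnnorm_le_add f.continuous g.continuous hF
  rw [map_add]
  exact (nnnorm_add_le _ _).trans
    (add_le_add (nnnorm_le_dualVariation L h₁) (nnnorm_le_dualVariation L h₂))

theorem le_dualVariation_add :
    dualVariation L f + dualVariation L g ≤ dualVariation L (f + g) := by
  have key : ∀ F : C₀(Z, E), (∀ x, ‖F x‖₊ ≤ f x) →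
      ‖L F‖₊ + dualVariation L g ≤ dualVariation L (f + g) := fun F hF => by
    have hG := fun G => nnnorm_add_nnnorm_le_dualVariation_add L (G := G) (g := g) hF
    exact (le_tsub_iff_left (le_self_add.trans (hG 0 (by simp)))).1
      (dualVariation_le L fun G hGg => le_tsub_of_add_le_left (hG G hGg))
  exact (le_tsub_iff_right (le_add_self.trans (key 0 (by simp)))).1
    (dualVariation_le L fun F hF => le_tsub_of_add_le_right (key F hF))

theorem mul_dualVariation_le (c : ℝ≥0) (f : C_c(Z, ℝ≥0)) :
    c * dualVariation L f ≤ dualVariation L (c • f) := by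
  rw [dualVariation, NNReal.mul_iSup]
  refine ciSup_le' fun ⟨F, hF⟩ => ?_
  have h := nnnorm_le_dualVariation L (F := (c : ℂ) • F) (f := c • f) fun x => by
    rw [ZeroAtInftyContinuousMap.smul_apply, nnnorm_smul, Complex.nnnorm_real, NNReal.nnnorm_eq]
    exact mul_le_mul_right (hF x) c
  rwa [map_smul, nnnorm_smul, Complex.nnnorm_real, NNReal.nnnorm_eq] at h

theorem dualVariation_smul (c : ℝ≥0) (f : C_c(Z, ℝ≥0)) :
    dualVariation L (c • f) = c * dualVariation L f := by
  rcases eq_or_ne c 0 with rfl | hc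
  · have hle := le_dualVariation_add L (f := 0) (g := 0)
    rw [add_zero, add_le_iff_nonpos_left] at hle
    rw [zero_smul, zero_mul, le_zero_iff.1 hle]
  · refine le_antisymm ?_ (mul_dualVariation_le L c f)
    have h := mul_dualVariation_le L c⁻¹ (c • f)
    rwa [inv_smul_smul₀ hc, inv_mul_le_iff₀ (pos_iff_ne_zero.2 hc)] at h

/-- The total variation of a functional on `C₀(Z, E)`, as a positive functional. -/
noncomputable def dualVariationLinear : C_c(Z, ℝ≥0) →ₗ[ℝ≥0] ℝ≥0 where
  toFun := dualVariation L
  map_add' _ _ := le_antisymm (dualVariation_add_le L) (le_dualVariation_add L)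
  map_smul' := dualVariation_smul L

variable [T2Space Z] [LocallyCompactSpace Z] [MeasurableSpace Z] [BorelSpace Z]

/-- The scalar measure that represents the total variation of a functional on `C₀(Z, E)`. -/
noncomputable def dualMeasure : Measure Z :=
  NNRealRMK.rieszMeasure (dualVariationLinear L)

instance : (dualMeasure L).Regular :=
  NNRealRMK.rieszMeasure_regular _

theorem dualMeasure_univ_le : dualMeasure L Set.univ ≤ ‖L‖₊ := by
  rw [isOpen_univ.measure_eq_iSup_isCompact]
  refine iSup₂_le fun C _ => iSup_le fun hC => ?_
  obtain ⟨φ, hφC, -, hφ, hφI⟩ := exists_continuous_one_zero_of_isCompact hC isClosed_empty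
    (Set.disjoint_empty C)
  let f : C_c(Z, ℝ≥0) := ⟨⟨fun x => (φ x).toNNReal, by fun_prop⟩,
    hφ.comp_left (g := Real.toNNReal) Real.toNNReal_zero⟩
  have hfC : ∀ x ∈ C, f x = 1 := fun x hx =>
    (congrArg Real.toNNReal (hφC hx)).trans Real.toNNReal_one
  have hf : ∀ x, f x ≤ 1 := fun x => Real.toNNReal_le_one.2 (hφI x).2
  calc dualMeasure L C ≤ ∫⁻ x, f x ∂dualMeasure L := by
        rw [← lintegral_indicator_one hC.measurableSet]
        refine lintegral_mono (Set.indicator_le fun x hx => ?_)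
        simp only [hfC x hx, Pi.one_apply, ENNReal.coe_one, le_refl]
    _ = dualVariation L f := NNRealRMK.lintegral_rieszMeasure (dualVariationLinear L) f
    _ ≤ ‖L‖₊ := ENNReal.coe_le_coe.2 (dualVariation_le L fun F hF =>
        (nnnorm_apply_le_of_forall L fun x => (hF x).trans (hf x)).trans (mul_one _).le)

instance : IsFiniteMeasure (dualMeasure L) :=
  ⟨(dualMeasure_univ_le L).trans_lt ENNReal.coe_lt_top⟩

theorem norm_le_integral_dualMeasure (F : C₀(Z, E)) : ‖L F‖ ≤ ∫ x, ‖F x‖ ∂dualMeasure L := by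
  have hint : Integrable (fun x => ‖F x‖) (dualMeasure L) :=
    Integrable.of_bound F.continuous.norm.aestronglyMeasurable ‖F‖
      (Eventually.of_forall fun x => (norm_norm _).trans_le (norm_zeroAtInfty_apply_le F x))
  have hε : ∀ ε : ℝ≥0, 0 < ε → ‖L F‖ ≤ ∫ x, ‖F x‖ ∂dualMeasure L + ‖L‖ * ε := fun ε hε => by
    obtain ⟨G, g, hFG, hGg, hgF⟩ := exists_norm_sub_le_nnnorm_le_compactlySupported F hε
    calc ‖L F‖ = ‖L G + L (F - G)‖ := by rw [← map_add, add_sub_cancel]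
      _ ≤ ‖L G‖ + ‖L (F - G)‖ := norm_add_le _ _
      _ ≤ dualVariation L g + ‖L‖ * ε :=
        add_le_add (nnnorm_le_dualVariation L hGg) (L.le_opNorm_of_le hFG)
      _ = ∫ x, (g x : ℝ) ∂dualMeasure L + ‖L‖ * ε := by
        rw [dualMeasure, NNRealRMK.integral_rieszMeasure]
        rfl
      _ ≤ ∫ x, ‖F x‖ ∂dualMeasure L + ‖L‖ * ε :=
        add_le_add_left (integral_mono_of_nonneg (Eventually.of_forall fun x => (g x).2) hint
          (Eventually.of_forall hgF)) _
  refine ge_of_tendsto (f := fun ε : ℝ≥0 => ∫ x, ‖F x‖ ∂dualMeasure L + ‖L‖ * ε)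
    (x := 𝓝[>] 0) ?_ (eventually_mem_nhdsWithin.mono hε)
  refine tendsto_nhdsWithin_of_tendsto_nhds (Continuous.tendsto' ?_ _ _ (by simp))
  fun_prop

end DualMeasure

section L2

variable [MeasurableSpace Z] [BorelSpace Z] [SecondCountableTopology Z] (μ : Measure Z)
  [IsFiniteMeasure μ]

theorem memLp_zeroAtInfty (p : ℝ≥0∞) (F : C₀(Z, E)) : MemLp F p μ :=
  MemLp.of_bound F.continuous.aestronglyMeasurable ‖F‖
    (Eventually.of_forall (norm_zeroAtInfty_apply_le F))

variable [NormedSpace ℂ E]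

/-- The inclusion `C₀(Z, E) → L²(μ, E)`. -/
noncomputable def zeroAtInftyToL2 : C₀(Z, E) →ₗ[ℂ] Lp E 2 μ where
  toFun F := (memLp_zeroAtInfty μ 2 F).toLp F
  map_add' F G := MemLp.toLp_add (memLp_zeroAtInfty μ 2 F) (memLp_zeroAtInfty μ 2 G)
  map_smul' c F := MemLp.toLp_const_smul c (memLp_zeroAtInfty μ 2 F)

theorem denseRange_zeroAtInftyToL2 [R1Space Z] [WeaklyLocallyCompactSpace Z] [μ.Regular] :
    DenseRange (zeroAtInftyToL2 μ : C₀(Z, E) →ₗ[ℂ] Lp E 2 μ) := by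
  refine Metric.dense_iff.2 fun u r hr => ?_
  obtain ⟨g, hgs, hug, hgc, hg⟩ := (Lp.memLp u).exists_hasCompactSupport_eLpNorm_sub_le
    ENNReal.ofNat_ne_top (ENNReal.ofReal_pos.2 (half_pos hr)).ne'
  refine ⟨hg.toLp g, ?_, ⟨⟨⟨g, hgc⟩, hgs.is_zero_at_infty⟩, rfl⟩⟩
  rw [Metric.mem_ball, dist_comm, dist_edist, ← Lp.toLp_coeFn u (Lp.memLp u),
    Lp.edist_toLp_toLp]
  exact (ENNReal.toReal_le_of_le_ofReal (half_pos hr).le hug).trans_lt (half_lt_self hr)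

theorem integral_norm_le_norm_zeroAtInftyToL2 (F : C₀(Z, E)) :
    ∫ x, ‖F x‖ ∂μ ≤ μ.real Set.univ ^ (1 / 2 : ℝ) * ‖zeroAtInftyToL2 μ F‖ := by
  have hF := memLp_zeroAtInfty μ 2 F
  have hle : eLpNorm F 1 μ ≤ eLpNorm F 2 μ * μ Set.univ ^ (1 / 2 : ℝ) :=
    (eLpNorm_le_eLpNorm_mul_rpow_measure_univ one_le_two hF.aestronglyMeasurable).trans_eq
      (by norm_num)
  calc ∫ x, ‖F x‖ ∂μ = (eLpNorm F 1 μ).toReal := by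
        rw [integral_norm_eq_lintegral_enorm hF.aestronglyMeasurable,
          eLpNorm_one_eq_lintegral_enorm]
    _ ≤ (eLpNorm F 2 μ * μ Set.univ ^ (1 / 2 : ℝ)).toReal :=
        ENNReal.toReal_mono (ENNReal.mul_ne_top hF.eLpNorm_ne_top
          (ENNReal.rpow_ne_top_of_nonneg (by norm_num) (measure_ne_top μ _))) hle
    _ = μ.real Set.univ ^ (1 / 2 : ℝ) * ‖zeroAtInftyToL2 μ F‖ := by
        rw [ENNReal.toReal_mul, ← ENNReal.toReal_rpow, mul_comm]
        exact congrArg _ (Lp.norm_toLp F hF).symm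

theorem exists_integral_inner_eq_of_norm_le {H : Type*} [NormedAddCommGroup H]
    [InnerProductSpace ℂ H] [CompleteSpace H] [R1Space Z] [WeaklyLocallyCompactSpace Z]
    [μ.Regular] {L : C₀(Z, H) →L[ℂ] ℂ} (hL : ∀ F : C₀(Z, H), ‖L F‖ ≤ ∫ x, ‖F x‖ ∂μ) :
    ∃ h : Z → H, Integrable h μ ∧ ∀ F : C₀(Z, H), ∫ x, inner ℂ (h x) (F x) ∂μ = L F := by
  obtain ⟨Λ, hΛ⟩ : ∃ Λ : Lp H 2 μ →L[ℂ] ℂ, ∀ F : C₀(Z, H), Λ (zeroAtInftyToL2 μ F) = L F :=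
    ⟨L.toLinearMap.extendOfNorm (zeroAtInftyToL2 μ),
      LinearMap.extendOfNorm_eq (denseRange_zeroAtInftyToL2 μ)
        ⟨_, fun F => (hL F).trans (integral_norm_le_norm_zeroAtInftyToL2 μ F)⟩⟩
  obtain ⟨h, hh⟩ : ∃ h : Lp H 2 μ, ∀ u, inner ℂ h u = Λ u :=
    ⟨(InnerProductSpace.toDual ℂ (Lp H 2 μ)).symm Λ, fun u =>
      InnerProductSpace.toDual_symm_apply⟩
  refine ⟨h, (Lp.memLp h).integrable one_le_two, fun F => ?_⟩
  rw [← hΛ, ← hh, L2.inner_def]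
  exact integral_congr_ae ((memLp_zeroAtInfty μ 2 F).coeFn_toLp.mono fun x hx =>
    congrArg (inner ℂ (h x)) hx.symm)

end L2

theorem exists_isRadon_bartleIntegral_eq [T2Space Z] [LocallyCompactSpace Z]
    [SecondCountableTopology Z] [MeasurableSpace Z] [BorelSpace Z] {H : Type*}
    [NormedAddCommGroup H] [InnerProductSpace ℂ H] [CompleteSpace H] (L : C₀(Z, H) →L[ℂ] ℂ) :
    ∃ η : VectorMeasure Z H, IsRadon η ∧ ∀ F : C₀(Z, H), bartleIntegral F η = L F := by
  obtain ⟨h, hh, hL⟩ := exists_integral_inner_eq_of_norm_le (dualMeasure L)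
    (norm_le_integral_dualMeasure L)
  have hfin : IsFiniteMeasure ((dualMeasure L).withDensityᵥ h).variation := by
    rw [Measure.variation_withDensityᵥ hh]
    exact isFiniteMeasure_withDensity hh.2.ne
  refine ⟨(dualMeasure L).withDensityᵥ h, ⟨hfin, inferInstance⟩, fun F => ?_⟩
  rw [bartleIntegral_withDensityᵥ hh (memLp_one_iff_integrable.1 (memLp_zeroAtInfty _ 1 F)), hL]

end Riesz

section DifferentiatedKernels

variable {m q : ℕ} {U : Set (EuclideanSpace ℝ (Fin m))} {H : Type*} [NormedAddCommGroup H]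
  [InnerProductSpace ℂ H]

theorem strongDeriv_eq {α : Fin m → ℕ} {L : U → H →L[ℂ] H} {x : U} {T : H →L[ℂ] H}
    (hT : ∀ v, T v = dAlpha α (fun x' => L x' v) x) : strongDeriv α L x = T := by
  have hex : ∃ T : H →L[ℂ] H, ∀ v, T v = dAlpha α (fun x' => L x' v) x := ⟨T, hT⟩
  rw [strongDeriv, dif_pos hex]
  exact ContinuousLinearMap.ext fun v => (hex.choose_spec v).trans (hT v).symm

theorem weakDeriv_eq {β : Fin m → ℕ} {L : U → H →L[ℂ] H} {y : U} {T : H →L[ℂ] H}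
    (hT : ∀ u v, inner ℂ u (T v) = dAlpha β (fun y' => inner ℂ u (L y' v)) y) :
    weakDeriv β L y = T := by
  have hex : ∃ T : H →L[ℂ] H, ∀ u v,
      inner ℂ u (T v) = dAlpha β (fun y' => inner ℂ u (L y' v)) y := ⟨T, hT⟩
  rw [weakDeriv, dif_pos hex]
  exact ContinuousLinearMap.ext fun v =>
    ext_inner_left ℂ fun u => (hex.choose_spec u v).trans (hT u v).symm

namespace HasStrongDerivs

variable [CompleteSpace H] {W : Type*} [NormedAddCommGroup W] [InnerProductSpace ℂ W]
  [CompleteSpace W] {E : U → W →L[ℂ] H} {D : MultiIndex m q → U → W →L[ℂ] H}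
  {K : U → U → H →L[ℂ] H}

theorem isCq_inner_kernel (h : HasStrongDerivs E D) (hK : ∀ x y, K x y = E x ∘L (E y).adjoint)
    (x : U) (u v : H) : IsCq q fun y => inner ℂ u (K x y v) := by
  have hpairing : (fun y => inner ℂ u (K x y v)) = fun y => pairing H v (E y ((E x).adjoint u)) :=
    funext fun y => by
      rw [hK]
      exact ((E x).adjoint_inner_left _ u).symm.trans ((E y).adjoint_inner_right _ v)
  exact hpairing ▸ (h.isCq _).clm_comp (pairing H v)

theorem inner_comp_adjoint_eq_dAlpha (h : HasStrongDerivs E D) (hU : IsOpen U)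
    (hK : ∀ x y, K x y = E x ∘L (E y).adjoint) (β : MultiIndex m q) (x y : U) (u v : H) :
    inner ℂ u ((E x ∘L (D β y).adjoint) v) = dAlpha β.1 (fun y' => inner ℂ u (K x y' v)) y := by
  have hpairing : ∀ S : W →L[ℂ] H,
      inner ℂ u ((E x ∘L S.adjoint) v) = pairing H v (S ((E x).adjoint u)) := fun S =>
    ((E x).adjoint_inner_left _ u).symm.trans (S.adjoint_inner_right _ v)
  simp only [hK, hpairing]
  rw [(h.isCq _).dAlpha_clm_comp hU, h.dAlpha_eq]

theorem deriv₂_eq (h : HasStrongDerivs E D) (hU : IsOpen U)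
    (hK : ∀ x y, K x y = E x ∘L (E y).adjoint) (β : MultiIndex m q) (x y : U) :
    deriv₂ K β.1 x y = E x ∘L (D β y).adjoint :=
  weakDeriv_eq (h.inner_comp_adjoint_eq_dAlpha hU hK β x y)

theorem deriv₁_eq (h : HasStrongDerivs E D) (hK : ∀ x y, K x y = E x ∘L (E y).adjoint)
    (α : MultiIndex m q) (x y : U) : deriv₁ K α.1 x y = D α x ∘L (E y).adjoint :=
  strongDeriv_eq fun v => by simp only [hK, ContinuousLinearMap.comp_apply, h.dAlpha_eq]

theorem deriv₁₂_eq (h : HasStrongDerivs E D) (hU : IsOpen U)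
    (hK : ∀ x y, K x y = E x ∘L (E y).adjoint) (α β : MultiIndex m q) (x y : U) :
    deriv₁₂ K α.1 β.1 x y = D α x ∘L (D β y).adjoint :=
  strongDeriv_eq fun v => by
    simp only [h.deriv₂_eq hU hK, ContinuousLinearMap.comp_apply, h.dAlpha_eq]

theorem hasKernelDerivatives (h : HasStrongDerivs E D) (hU : IsOpen U)
    (hK : ∀ x y, K x y = E x ∘L (E y).adjoint) {C : (U → H) → Prop}
    (hC : ∀ w, C fun x => E x w) : HasKernelDerivatives q K C := by
  refine ⟨h.isCq_inner_kernel hK, fun β x y u v => ?_, fun β y v => ?_, fun α β x y v => ?_,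
    fun α x y => ?_⟩
  · rw [h.deriv₂_eq hU hK, h.inner_comp_adjoint_eq_dAlpha hU hK]
  · simp only [h.deriv₂_eq hU hK]
    exact hC ((D β y).adjoint v)
  · simp only [h.deriv₁₂_eq hU hK, h.deriv₂_eq hU hK, ContinuousLinearMap.comp_apply,
      h.dAlpha_eq]
  · rw [h.deriv₁_eq hK, ← h.zeroIndex_eq]
    exact h.deriv₁₂_eq hU hK α (zeroIndex m q) x y

section Potentials

variable {Z : Type*} [MeasurableSpace Z] {ι : Z → U} {η : MultiIndex m q → VectorMeasure Z H}
  {κ : MultiIndex m q → W}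

theorem isWeakIntegral_deriv₁ (h : HasStrongDerivs E D) (hK : ∀ x y, K x y = E x ∘L (E y).adjoint)
    (hκ : ∀ α, IsWeakIntegral (fun z => D α (ι z)) (η α) (κ α)) (α : MultiIndex m q) (y : U) :
    IsWeakIntegral (fun z => deriv₁ K α.1 (ι z) y) (η α) (E y (κ α)) := by
  simpa only [h.deriv₁_eq hK] using (hκ α).comp_adjoint (E y)

theorem isWeakIntegral_deriv₁₂ (h : HasStrongDerivs E D) (hU : IsOpen U)
    (hK : ∀ x y, K x y = E x ∘L (E y).adjoint)
    (hκ : ∀ α, IsWeakIntegral (fun z => D α (ι z)) (η α) (κ α)) (α β : MultiIndex m q) (y : U) :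
    IsWeakIntegral (fun z => deriv₁₂ K α.1 β.1 (ι z) y) (η α) (D β y (κ α)) := by
  simpa only [h.deriv₁₂_eq hU hK] using (hκ α).comp_adjoint (D β y)

theorem potentialTerm_eq (h : HasStrongDerivs E D) (hU : IsOpen U)
    (hK : ∀ x y, K x y = E x ∘L (E y).adjoint)
    (hκ : ∀ α, IsWeakIntegral (fun z => D α (ι z)) (η α) (κ α)) (α β : MultiIndex m q) (y : U) :
    potentialTerm K ι η α β y = D β y (κ α) :=
  (h.isWeakIntegral_deriv₁₂ hU hK hκ α β y).weakBochnerIntegral_eq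

theorem kernelPotential_eq (h : HasStrongDerivs E D) (hK : ∀ x y, K x y = E x ∘L (E y).adjoint)
    (hκ : ∀ α, IsWeakIntegral (fun z => D α (ι z)) (η α) (κ α)) :
    kernelPotential K ι η = fun y => E y (∑ α, κ α) := by
  funext y
  rw [kernelPotential, map_sum]
  exact Finset.sum_congr rfl fun α _ => (h.isWeakIntegral_deriv₁ hK hκ α y).weakBochnerIntegral_eq

theorem weakBochnerIntegrable_deriv₁ (h : HasStrongDerivs E D)
    (hK : ∀ x y, K x y = E x ∘L (E y).adjoint)
    (hκ : ∀ α, IsWeakIntegral (fun z => D α (ι z)) (η α) (κ α))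
    (hint : ∀ α w, Integrable (fun z => D α (ι z) w) (η α).variation) (α : MultiIndex m q)
    (y : U) : WeakBochnerIntegrable (fun z => deriv₁ K α.1 (ι z) y) (η α) :=
  (h.isWeakIntegral_deriv₁ hK hκ α y).weakBochnerIntegrable fun v => by
    simp only [h.deriv₁_eq hK]
    exact hint α ((E y).adjoint v)

theorem derivativeFormula (h : HasStrongDerivs E D) (hU : IsOpen U)
    (hK : ∀ x y, K x y = E x ∘L (E y).adjoint)
    (hκ : ∀ α, IsWeakIntegral (fun z => D α (ι z)) (η α) (κ α))
    (hint : ∀ α w, Integrable (fun z => D α (ι z) w) (η α).variation) :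
    DerivativeFormula K ι η := by
  refine fun β y => ⟨fun α => ?_, ?_⟩
  · refine (h.isWeakIntegral_deriv₁₂ hU hK hκ α β y).weakBochnerIntegrable fun v => ?_
    simp only [h.deriv₁₂_eq hU hK]
    exact hint α ((D β y).adjoint v)
  · rw [h.kernelPotential_eq hK hκ, h.dAlpha_eq]
    exact (map_sum (D β y) κ Finset.univ).trans
      (Finset.sum_congr rfl fun α _ => (h.potentialTerm_eq hU hK hκ α β y).symm)

theorem doubleIntegralFormula (h : HasStrongDerivs E D) (hU : IsOpen U)
    (hK : ∀ x y, K x y = E x ∘L (E y).adjoint)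
    (hκ : ∀ α, IsWeakIntegral (fun z => D α (ι z)) (η α) (κ α))
    (hint : ∀ α w, Integrable (fun z => D α (ι z) w) (η α).variation) :
    DoubleIntegralFormula K ι η (inner ℂ (∑ α, κ α) (∑ α, κ α)) := by
  simp only [DoubleIntegralFormula, h.potentialTerm_eq hU hK hκ]
  refine ⟨fun α β => hint β (κ α), ?_⟩
  simp only [sum_inner, inner_sum]
  exact Finset.sum_congr rfl fun α _ => Finset.sum_congr rfl fun β _ => hκ β (κ α)

theorem densityFormula (h : HasStrongDerivs E D) (hU : IsOpen U)
    (hK : ∀ x y, K x y = E x ∘L (E y).adjoint)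
    (hκ : ∀ α, IsWeakIntegral (fun z => D α (ι z)) (η α) (κ α))
    (hint : ∀ α w, Integrable (fun z => D α (ι z) w) (η α).variation) :
    DensityFormula K ι η (inner ℂ (∑ α, κ α) (∑ α, κ α)) := by
  intro μ g _ hg hηg
  obtain rfl : η = fun α => μ.withDensityᵥ (g α) := funext fun α => VectorMeasure.ext fun s hs =>
    (hηg α s hs).trans (withDensityᵥ_apply (hg α) hs).symm
  have hinner : ∀ α w, Integrable (fun z => inner ℂ (g α z) (D α (ι z) w)) μ := fun α w =>
    integrable_inner_of_variation_withDensityᵥ (hg α) (hint α w)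
  have hintegral : ∀ α w, ∫ z, inner ℂ (g α z) (D α (ι z) w) ∂μ = inner ℂ (κ α) w := fun α w =>
    (bartleIntegral_withDensityᵥ (hg α) (hint α w)).symm.trans (hκ α w).symm
  have hx : ∀ (α β : MultiIndex m q) (y : Z),
      ∫ x, inner ℂ (g α x) (deriv₁₂ K α.1 β.1 (ι x) (ι y) (g β y)) ∂μ =
        starRingEnd ℂ (inner ℂ (g β y) (D β (ι y) (κ α))) := fun α β y => by
    simp only [h.deriv₁₂_eq hU hK, ContinuousLinearMap.comp_apply, hintegral]
    rw [ContinuousLinearMap.adjoint_inner_right, inner_conj_symm]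
  refine ⟨fun α β y => ?_, fun α β => ?_, ?_⟩
  · simp only [h.deriv₁₂_eq hU hK]
    exact hinner α ((D β (ι y)).adjoint (g β y))
  · simp only [hx]
    exact (LinearIsometryEquiv.integrable_comp_iff RCLike.conjLIE).2 (hinner β (κ α))
  · have hxy : ∀ α β, ∫ y, starRingEnd ℂ (inner ℂ (g β y) (D β (ι y) (κ α))) ∂μ =
        inner ℂ (κ α) (κ β) := fun α β => by
      rw [integral_conj, hintegral, inner_conj_symm]
    simp only [hx, hxy, sum_inner, inner_sum]
    exact Finset.sum_comm

end Potentials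

end HasStrongDerivs

end DifferentiatedKernels

section KernelSpaces

variable {H : Type*} [NormedAddCommGroup H] [InnerProductSpace ℂ H] [CompleteSpace H]

/-- The evaluation `f ↦ f x` on the reproducing kernel Hilbert space of `K`, as the adjoint of the
operator `v ↦ K(·, x) v`. -/
noncomputable def evalKernelSpace {X : Type*} {K : X → X → H →L[ℂ] H}
    (hK : IsPositiveDefiniteKernel K) (x : X) : KernelSpace K hK →L[ℂ] H :=
  haveI : Fact (Matrix.of K).PosSemidef := ⟨hK.posSemidef⟩
  (RKHS.kerFun (RKHS.OfKernel (Matrix.of K)) x).adjoint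

theorem evalKernelSpace_apply {X : Type*} {K : X → X → H →L[ℂ] H}
    (hK : IsPositiveDefiniteKernel K) (x : X) (f : KernelSpace K hK) :
    evalKernelSpace hK x f = f x :=
  have : Fact (Matrix.of K).PosSemidef := ⟨hK.posSemidef⟩
  RKHS.adjoint_kerFun x f

theorem evalKernelSpace_comp_adjoint {X : Type*} {K : X → X → H →L[ℂ] H}
    (hK : IsPositiveDefiniteKernel K) (x y : X) :
    K x y = evalKernelSpace hK x ∘L (evalKernelSpace hK y).adjoint := by
  have : Fact (Matrix.of K).PosSemidef := ⟨hK.posSemidef⟩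
  have h := RKHS.kernel_apply (RKHS.OfKernel (Matrix.of K)) x y
  rw [RKHS.OfKernel.kernel_ofKernel] at h
  rw [evalKernelSpace, evalKernelSpace, ContinuousLinearMap.adjoint_adjoint]
  exact h

variable {m q : ℕ} {U : Set (EuclideanSpace ℝ (Fin m))} {K : U → U → H →L[ℂ] H}
  {hK : IsPositiveDefiniteKernel K}

theorem exists_hasStrongDerivs_evalKernelSpace (hU : IsOpen U)
    (hE : ∀ f : KernelSpace K hK, IsCq q (f : U → H)) :
    ∃ D : MultiIndex m q → U → KernelSpace K hK →L[ℂ] H,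
      HasStrongDerivs (evalKernelSpace hK) D ∧
      ∀ α (f : KernelSpace K hK), dAlpha α.1 (f : U → H) = fun x => D α x f := by
  obtain ⟨D, hD⟩ := HasStrongDerivs.exists_of_isCq (q := q) (E := evalKernelSpace hK) hU fun f => by
    simpa only [evalKernelSpace_apply] using hE f
  exact ⟨D, hD, fun α f => by simpa only [evalKernelSpace_apply] using hD.dAlpha_eq α f⟩

theorem hasKernelDerivatives_of_kernelSpace (hU : IsOpen U)
    (hE : ∀ f : KernelSpace K hK, IsCq q (f : U → H)) {C : (U → H) → Prop}
    (hC : ∀ f : KernelSpace K hK, C f) : HasKernelDerivatives q K C := by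
  obtain ⟨D, hD, -⟩ := exists_hasStrongDerivs_evalKernelSpace hU hE
  refine hD.hasKernelDerivatives hU (evalKernelSpace_comp_adjoint hK) fun f => ?_
  simpa only [evalKernelSpace_apply] using hC f

variable {Z : Type*} [MeasurableSpace Z] {ι : Z → U} {η : MultiIndex m q → VectorMeasure Z H}

theorem exists_isPotential (hU : IsOpen U) (hE : ∀ f : KernelSpace K hK, IsCq q (f : U → H))
    (hint : ∀ (α : MultiIndex m q) (f : KernelSpace K hK),
      Integrable (fun z => dAlpha α.1 f (ι z)) (η α).variation) :
    ∃ k : KernelSpace K hK,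
      (∀ f : KernelSpace K hK,
        inner ℂ k f = ∑ α, bartleIntegral (fun z => dAlpha α.1 f (ι z)) (η α)) ∧
      IsPotential K hK ι η k ∧ DerivativeFormula K ι η ∧
      DoubleIntegralFormula K ι η (inner ℂ k k) ∧ DensityFormula K ι η (inner ℂ k k) := by
  obtain ⟨D, hD, hdAlpha⟩ := exists_hasStrongDerivs_evalKernelSpace hU hE
  have hfactor := evalKernelSpace_comp_adjoint hK
  simp only [hdAlpha] at hint ⊢
  choose κ hκ using fun α => IsWeakIntegral.exists_of_integrable (hint α)
  have hpotential : (∑ α, κ α : KernelSpace K hK) = kernelPotential K ι η := by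
    simpa only [evalKernelSpace_apply] using (hD.kernelPotential_eq hfactor hκ).symm
  exact ⟨∑ α, κ α,
    fun f => (sum_inner _ _ _).trans (Finset.sum_congr rfl fun α _ => hκ α f),
    ⟨hD.weakBochnerIntegrable_deriv₁ hfactor hκ hint, hpotential⟩,
    hD.derivativeFormula hU hfactor hκ hint, hD.doubleIntegralFormula hU hfactor hκ hint,
    hD.densityFormula hU hfactor hκ hint⟩

theorem IsPotential.unique {k k' : KernelSpace K hK} (hk : IsPotential K hK ι η k)
    (hk' : IsPotential K hK ι η k') : k = k' :=
  DFunLike.coe_injective (hk.2.trans hk'.2.symm)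

theorem exists_isPotential_inner_self_pos_iff (hU : IsOpen U)
    (hE : ∀ f : KernelSpace K hK, IsCq q (f : U → H))
    (hint : ∀ (α : MultiIndex m q) (f : KernelSpace K hK),
      Integrable (fun z => dAlpha α.1 f (ι z)) (η α).variation) :
    (∃ k, IsPotential K hK ι η k ∧ 0 < inner ℂ k k) ↔
      ∃ f : KernelSpace K hK,
        ∑ α, bartleIntegral (fun z => dAlpha α.1 f (ι z)) (η α) ≠ 0 := by
  obtain ⟨k, hinner, hk, -⟩ := exists_isPotential hU hE hint
  simp only [← hinner]
  constructor
  · rintro ⟨k', hk', hpos⟩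
    exact ⟨k, by simpa only [hk'.unique hk] using hpos.ne'⟩
  · rintro ⟨f, hf⟩
    have hk0 : k ≠ 0 := fun h => hf (by rw [h, inner_zero_left])
    refine ⟨k, hk, ?_⟩
    rw [inner_self_eq_norm_sq_to_K, ← RCLike.ofReal_pow]
    exact RCLike.ofReal_pos.2 (pow_pos (norm_pos_iff.2 hk0) 2)

end KernelSpaces

section Approximation

open scoped ZeroAtInfty

theorem mem_closure_submodule_iff_forall_dual {𝕜 X : Type*} [RCLike 𝕜] [NormedAddCommGroup X]
    [NormedSpace 𝕜 X] {S : Submodule 𝕜 X} {x : X} :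
    x ∈ closure (S : Set X) ↔ ∀ L : X →L[𝕜] 𝕜, (∀ y ∈ S, L y = 0) → L x = 0 := by
  constructor
  · exact fun hx L hL => closure_minimal hL (isClosed_eq L.continuous continuous_const) hx
  · intro hx
    have : IsClosed (S.topologicalClosure : Set X) := S.isClosed_topologicalClosure
    suffices S.topologicalClosure.mkQ x = 0 by
      rwa [Submodule.mkQ_apply, Submodule.Quotient.mk_eq_zero] at this
    refine SeparatingDual.eq_zero_of_forall_dual_eq_zero (R := 𝕜) fun L =>
      hx (L ∘L S.topologicalClosure.mkQL) fun y hy => ?_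
    have hy0 : S.topologicalClosure.mkQL y = 0 :=
      (Submodule.Quotient.mk_eq_zero _).2 (S.le_topologicalClosure hy)
    rw [ContinuousLinearMap.comp_apply, hy0, map_zero]

variable {Z J : Type*} [TopologicalSpace Z] [Fintype J]

theorem mem_closure_pi_zeroAtInfty_iff {E : Type*} [NormedAddCommGroup E]
    {S : Set (J → C₀(Z, E))} {G : J → C₀(Z, E)} :
    G ∈ closure S ↔ ∀ ε > (0 : ℝ), ∃ F ∈ S, ∀ z, ∑ α, ‖F α z - G α z‖ < ε := by
  rw [Metric.mem_closure_iff]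
  constructor
  · intro h ε hε
    obtain ⟨F, hF, hGF⟩ := h (ε / (Fintype.card J + 1)) (by positivity)
    refine ⟨F, hF, fun z => ?_⟩
    calc ∑ α, ‖F α z - G α z‖ ≤ ∑ _α : J, ‖F - G‖ := Finset.sum_le_sum fun α _ =>
          (norm_zeroAtInfty_apply_le ((F - G) α) z).trans (norm_le_pi_norm (F - G) α)
      _ = Fintype.card J * dist G F := by
          rw [Finset.sum_const, nsmul_eq_mul, dist_comm, dist_eq_norm]; rfl
      _ ≤ Fintype.card J * (ε / (Fintype.card J + 1)) := by gcongr
      _ < ε := by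
          rw [mul_div_assoc', div_lt_iff₀ (by positivity)]
          linarith
  · intro h ε hε
    obtain ⟨F, hF, hFG⟩ := h (ε / 2) (half_pos hε)
    refine ⟨F, hF, lt_of_le_of_lt ?_ (half_lt_self hε)⟩
    rw [dist_comm, dist_eq_norm, pi_norm_le_iff_of_nonneg (half_pos hε).le]
    refine fun α => (norm_zeroAtInfty_le_iff (half_pos hε).le).2 fun z => le_trans ?_ (hFG z).le
    exact Finset.single_le_sum (f := fun α => ‖F α z - G α z‖) (fun _ _ => norm_nonneg _)
      (Finset.mem_univ α)

variable [MeasurableSpace Z] [BorelSpace Z] [SecondCountableTopology Z]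

theorem integrable_of_tendsto_cocompact {E : Type*} [NormedAddCommGroup E] {μ : Measure Z}
    [IsFiniteMeasure μ] {F : Z → E} (hF : Continuous F) (h0 : Tendsto F (cocompact Z) (𝓝 0)) :
    Integrable F μ :=
  memLp_one_iff_integrable.1 (memLp_zeroAtInfty μ 1 ⟨⟨F, hF⟩, h0⟩)

variable {H : Type*} [NormedAddCommGroup H] [InnerProductSpace ℂ H]

/-- The continuous linear functional `F ↦ ∫ ⟨F, dη⟩` on `C₀(Z, H)` given by an `H`-valued measure
of finite variation. -/
noncomputable def integralDual (η : VectorMeasure Z H) [IsFiniteMeasure η.variation] :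
    C₀(Z, H) →L[ℂ] ℂ :=
  LinearMap.mkContinuous
    { toFun := fun F => bartleIntegral F η
      map_add' := fun F G =>
        bartleIntegral_add (memLp_one_iff_integrable.1 (memLp_zeroAtInfty _ 1 F))
          (memLp_one_iff_integrable.1 (memLp_zeroAtInfty _ 1 G))
      map_smul' := fun c F => bartleIntegral_smul c F }
    (η.variation.real Set.univ) fun F =>
      (norm_bartleIntegral_le (norm_nonneg F) (norm_zeroAtInfty_apply_le F)).trans_eq
        (mul_comm _ _)

theorem integralDual_apply (η : VectorMeasure Z H) [IsFiniteMeasure η.variation] (F : C₀(Z, H)) :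
    integralDual η F = bartleIntegral F η :=
  rfl

variable [CompleteSpace H] [T2Space Z] [LocallyCompactSpace Z]

theorem exists_isRadon_sum_bartleIntegral_eq (L : (J → C₀(Z, H)) →L[ℂ] ℂ) :
    ∃ η : J → VectorMeasure Z H, (∀ α, IsRadon (η α)) ∧
      ∀ F, ∑ α, bartleIntegral (F α) (η α) = L F := by
  classical
  choose η hη hL using fun α => exists_isRadon_bartleIntegral_eq
    (L ∘L ContinuousLinearMap.single ℂ (fun _ : J => C₀(Z, H)) α)
  refine ⟨η, hη, fun F => ?_⟩
  simp only [hL, ContinuousLinearMap.comp_apply]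
  rw [← map_sum]
  exact congrArg L (Finset.univ_sum_single F)

theorem mem_closure_iff_forall_sum_bartleIntegral {S : Submodule ℂ (J → C₀(Z, H))}
    {G : J → C₀(Z, H)} :
    G ∈ closure (S : Set (J → C₀(Z, H))) ↔
      ∀ η : J → VectorMeasure Z H, (∀ α, IsRadon (η α)) →
        (∀ F ∈ S, ∑ α, bartleIntegral (F α) (η α) = 0) →
          ∑ α, bartleIntegral (G α) (η α) = 0 := by
  rw [mem_closure_submodule_iff_forall_dual]
  constructor
  · intro hG η hη
    have hfin : ∀ α, IsFiniteMeasure (η α).variation := fun α => (hη α).1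
    let L : (J → C₀(Z, H)) →L[ℂ] ℂ :=
      ∑ α, integralDual (η α) ∘L ContinuousLinearMap.proj (R := ℂ) (φ := fun _ : J => C₀(Z, H)) α
    have hL : ∀ F, L F = ∑ α, bartleIntegral (F α) (η α) := fun F => by
      simp only [L, sum_apply, ContinuousLinearMap.comp_apply,
        ContinuousLinearMap.proj_apply, integralDual_apply]
    simpa only [hL] using hG L
  · intro hG L
    obtain ⟨η, hη, hL⟩ := exists_isRadon_sum_bartleIntegral_eq L
    simpa only [hL] using hG η hη

end Approximation

section Universality

open scoped ZeroAtInfty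

variable {H : Type*} [NormedAddCommGroup H] [InnerProductSpace ℂ H] [CompleteSpace H]
  {m q : ℕ} {U : Set (EuclideanSpace ℝ (Fin m))} {K : U → U → H →L[ℂ] H}
  {hK : IsPositiveDefiniteKernel K}

section Restriction

variable {Z : Type*} [TopologicalSpace Z] {ι : Z → U}

theorem exists_linearMap_apply_eq_dAlpha (hU : IsOpen U)
    (hE : ∀ f : KernelSpace K hK, IsCq q (f : U → H)) (hι : Continuous ι)
    (h0 : ∀ (α : MultiIndex m q) (f : KernelSpace K hK),
      Tendsto (fun z => dAlpha α.1 f (ι z)) (cocompact Z) (𝓝 0)) :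
    ∃ T : KernelSpace K hK →ₗ[ℂ] (MultiIndex m q → C₀(Z, H)),
      ∀ f α, (T f α : Z → H) = fun z => dAlpha α.1 (f : U → H) (ι z) := by
  obtain ⟨D, hD, hdAlpha⟩ := exists_hasStrongDerivs_evalKernelSpace hU hE
  simp only [hdAlpha] at h0 ⊢
  exact ⟨{
    toFun := fun f α => ⟨⟨fun z => D α (ι z) f, (hD.continuous_apply hU α f).comp hι⟩, h0 α f⟩
    map_add' := fun f g => funext fun α => ZeroAtInftyContinuousMap.ext fun z =>
      map_add (D α (ι z)) f g
    map_smul' := fun c f => funext fun α => ZeroAtInftyContinuousMap.ext fun z =>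
      map_smul (D α (ι z)) c f }, fun f α => rfl⟩

theorem forall_exists_sum_norm_dAlpha_sub_lt_iff [MeasurableSpace Z] [BorelSpace Z]
    [SecondCountableTopology Z] [T2Space Z] [LocallyCompactSpace Z] (hU : IsOpen U)
    (hE : ∀ f : KernelSpace K hK, IsCq q (f : U → H)) (hι : Continuous ι)
    (h0 : ∀ (α : MultiIndex m q) (f : KernelSpace K hK),
      Tendsto (fun z => dAlpha α.1 f (ι z)) (cocompact Z) (𝓝 0))
    (G : MultiIndex m q → C₀(Z, H)) :
    (∀ ε > (0 : ℝ), ∃ f : KernelSpace K hK,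
      ∀ z, ∑ α, ‖dAlpha α.1 f (ι z) - G α z‖ < ε) ↔
    ∀ η : MultiIndex m q → VectorMeasure Z H, (∀ α, IsRadon (η α)) →
      ∑ α, bartleIntegral (G α) (η α) ≠ 0 →
      ∃ k, IsPotential K hK ι η k ∧ 0 < inner ℂ k k := by
  obtain ⟨T, hT⟩ := exists_linearMap_apply_eq_dAlpha hU hE hι h0
  have happrox := mem_closure_pi_zeroAtInfty_iff (S := (LinearMap.range T : Set _)) (G := G)
  rw [mem_closure_iff_forall_sum_bartleIntegral] at happrox
  simp only [SetLike.mem_coe, LinearMap.mem_range, exists_exists_eq_and,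
    forall_exists_index, forall_apply_eq_imp_iff, hT] at happrox
  rw [← happrox]
  refine forall₂_congr fun η hη => ?_
  have hfin : ∀ α, IsFiniteMeasure (η α).variation := fun α => (hη α).1
  rw [exists_isPotential_inner_self_pos_iff hU hE fun α f => integrable_of_tendsto_cocompact
    (((hE f).continuous_dAlpha hU α).comp hι) (h0 α f), ← not_forall_not, not_imp_not]
  simp only [not_not]

end Restriction

theorem isC0qUniversal_iff (hU : IsOpen U) (hE : ∀ f : KernelSpace K hK, IsC0q q (f : U → H)) :
    IsC0qUniversal q K hK ↔
      ∀ η : MultiIndex m q → VectorMeasure U H, (∀ α, IsRadon (η α)) →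
        (∃ F : U → H, IsC0q q F ∧ ∑ α, bartleIntegral (dAlpha α.1 F) (η α) ≠ 0) →
        ∃ k : KernelSpace K hK, IsPotential K hK id η k ∧ 0 < inner ℂ k k := by
  have : LocallyCompactSpace U := hU.locallyCompactSpace
  have happrox := fun (g : U → H) (hg : IsC0q q g) =>
    forall_exists_sum_norm_dAlpha_sub_lt_iff hU (fun f => (hE f).1) continuous_id
      (fun α f => ((hE f).2 α).2) fun α => ⟨⟨dAlpha α.1 g, (hg.2 α).1⟩, (hg.2 α).2⟩
  exact ⟨fun h η hη ⟨g, hg, hne⟩ => (happrox g hg).1 (h.2 g hg) η hη hne,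
    fun h => ⟨hE, fun g hg => (happrox g hg).2 fun η hη hne => h η hη ⟨g, hg, hne⟩⟩⟩

variable {A : Set (EuclideanSpace ℝ (Fin m))} {G : MultiIndex m q → A → H}

theorem IsCq.isCqClosure_restrict {V : Type*} [NormedAddCommGroup V] [NormedSpace ℝ V]
    (hU : IsOpen U) (hA : A ⊆ U) {g : U → V} (hg : IsCq q g) :
    IsCqClosure hA fun (α : MultiIndex m q) x => dAlpha α.1 g (Set.inclusion hA x) := by
  have heqOn : Set.EqOn (extendZero g)
      (extendZero fun x : A => dAlpha (zeroIndex m q).1 g (Set.inclusion hA x)) (interior A) :=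
    fun x hx => by
      have hxA := interior_subset hx
      rw [extendZero_apply g ⟨x, hA hxA⟩, extendZero_apply _ ⟨x, hxA⟩]
      exact (congrFun (dAlpha_zero g) ⟨x, hA hxA⟩).symm
  refine ⟨⟨fun α => (hg.continuous_dAlpha hU α).comp (continuous_inclusion hA),
    (hg.mono (interior_subset.trans hA)).congr heqOn.symm, fun α x hx => ?_⟩,
    fun ε hε => ⟨g, hg, fun x => by simpa using hε⟩⟩
  change iterPartial α.1 (extendZero g) x = _
  rw [iterPartial_eq_foldr, iterPartial_eq_foldr]
  exact eqOn_foldr_partialDeriv isOpen_interior heqOn _ hx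

theorem forall_exists_sum_norm_dAlpha_sub_lt_iff_of_isCompact (hU : IsOpen U)
    (hE : ∀ f : KernelSpace K hK, IsCq q (f : U → H)) (hA : A ⊆ U) (hAc : IsCompact A)
    (hG : ∀ α, Continuous (G α)) :
    (∀ ε > (0 : ℝ), ∃ f : KernelSpace K hK,
      ∀ z, ∑ α : MultiIndex m q, ‖dAlpha α.1 f (Set.inclusion hA z) - G α z‖ < ε) ↔
    ∀ η : MultiIndex m q → VectorMeasure A H, (∀ α, IsRadon (η α)) →
      ∑ α, bartleIntegral (G α) (η α) ≠ 0 →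
      ∃ k, IsPotential K hK (Set.inclusion hA) η k ∧ 0 < inner ℂ k k := by
  have : CompactSpace A := isCompact_iff_compactSpace.1 hAc
  exact forall_exists_sum_norm_dAlpha_sub_lt_iff hU hE (continuous_inclusion hA)
    (fun α f => by simp) fun α => ⟨⟨G α, hG α⟩, by simp⟩

theorem IsCqUniversal.exists_sum_norm_dAlpha_sub_lt (h : IsCqUniversal q K hK) (hA : A ⊆ U)
    (hAc : IsCompact A) (hG : IsCqClosure hA G) {ε : ℝ} (hε : 0 < ε) :
    ∃ f : KernelSpace K hK,
      ∀ z, ∑ α : MultiIndex m q, ‖dAlpha α.1 f (Set.inclusion hA z) - G α z‖ < ε := by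
  obtain ⟨g, hg, hgG⟩ := hG.2 (ε / 2) (half_pos hε)
  have hAc' : IsCompact (Subtype.val ⁻¹' A : Set U) :=
    (IsInducing.subtypeVal.isCompact_preimage_iff (by simpa using hA)).2 hAc
  obtain ⟨f, hf⟩ := h.2 _ hAc' g hg (ε / 2) (half_pos hε)
  refine ⟨f, fun z => ?_⟩
  calc ∑ α : MultiIndex m q, ‖dAlpha α.1 f (Set.inclusion hA z) - G α z‖
      ≤ ∑ α : MultiIndex m q,
          (‖dAlpha α.1 f (Set.inclusion hA z) - dAlpha α.1 g (Set.inclusion hA z)‖ +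
            ‖dAlpha α.1 g (Set.inclusion hA z) - G α z‖) :=
        Finset.sum_le_sum fun α _ => norm_sub_le_norm_sub_add_norm_sub _ _ _
    _ < ε / 2 + ε / 2 := by
        rw [Finset.sum_add_distrib]
        exact add_lt_add (hf (Set.inclusion hA z) z.2) (hgG z)
    _ = ε := add_halves ε

theorem exists_isCompact_closure_interior_eq_between {X : Type*} [TopologicalSpace X] [T2Space X]
    [LocallyCompactSpace X] {S V : Set X} (hS : IsCompact S) (hV : IsOpen V) (hSV : S ⊆ V) :
    ∃ B, IsCompact B ∧ closure (interior B) = B ∧ S ⊆ B ∧ B ⊆ V := by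
  obtain ⟨O, hO, hSO, hOV, hOc⟩ := exists_open_between_and_isCompact_closure hS hV hSV
  refine ⟨closure O, hOc, ?_, hSO.trans subset_closure, hOV⟩
  rw [← hO.interior_eq, closure_interior_idem]

theorem isCqUniversal_iff (hU : IsOpen U) (hE : ∀ f : KernelSpace K hK, IsCq q (f : U → H)) :
    IsCqUniversal q K hK ↔
      ∀ (A : Set (EuclideanSpace ℝ (Fin m))) (hA : A ⊆ U), IsCompact A →
        closure (interior A) = A →
        ∀ η : MultiIndex m q → VectorMeasure A H, (∀ α, IsRadon (η α)) →
        (∃ G : MultiIndex m q → A → H, IsCqClosure hA G ∧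
          ∑ α, bartleIntegral (G α) (η α) ≠ 0) →
        ∃ k : KernelSpace K hK, IsPotential K hK (Set.inclusion hA) η k ∧ 0 < inner ℂ k k := by
  refine ⟨fun h A hA hAc _ η hη ⟨G, hG, hne⟩ => ?_, fun h => ⟨hE, fun A hA g hg => ?_⟩⟩
  · exact (forall_exists_sum_norm_dAlpha_sub_lt_iff_of_isCompact hU hE hA hAc hG.1.1).1
      (fun ε hε => h.exists_sum_norm_dAlpha_sub_lt hA hAc hG hε) η hη hne
  · obtain ⟨B, hBc, hBreg, hAB, hBU⟩ := exists_isCompact_closure_interior_eq_between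
      (hA.image continuous_subtype_val) hU (Subtype.coe_image_subset U A)
    have hgB := hg.isCqClosure_restrict hU hBU
    intro ε hε
    obtain ⟨f, hf⟩ := (forall_exists_sum_norm_dAlpha_sub_lt_iff_of_isCompact hU hE hBU hBc
      hgB.1.1).2 (fun η hη hne => h B hBU hBc hBreg η hη ⟨_, hgB, hne⟩) ε hε
    exact ⟨f, fun x hx => hf ⟨x.1, hAB ⟨x, hx, rfl⟩⟩⟩

end Universality

theorem mainTheorem4_general {H : Type*} [NormedAddCommGroup H] [InnerProductSpace ℂ H]
    [CompleteSpace H] (m q : ℕ) (U : Set (EuclideanSpace ℝ (Fin m))) (hU : IsOpen U)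
    (K : U → U → H →L[ℂ] H) (hK : IsPositiveDefiniteKernel K) :
    ((∀ F : KernelSpace K hK, IsC0q q (F : U → H)) →
      HasKernelDerivatives q K (IsC0q q) ∧
      (∀ η : MultiIndex m q → VectorMeasure U H, (∀ α, IsRadon (η α)) →
        ∃ k : KernelSpace K hK, IsPotential K hK id η k ∧ DerivativeFormula K id η ∧
          DoubleIntegralFormula K id η (inner ℂ k k) ∧ DensityFormula K id η (inner ℂ k k)) ∧
      (IsC0qUniversal q K hK ↔
        ∀ η : MultiIndex m q → VectorMeasure U H, (∀ α, IsRadon (η α)) →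
          (∃ F : U → H, IsC0q q F ∧ ∑ α, bartleIntegral (dAlpha α.1 F) (η α) ≠ 0) →
          ∃ k : KernelSpace K hK, IsPotential K hK id η k ∧ 0 < inner ℂ k k)) ∧
    ((∀ F : KernelSpace K hK, IsCq q (F : U → H)) →
      HasKernelDerivatives q K (IsCq q) ∧
      (∀ (A : Set (EuclideanSpace ℝ (Fin m))) (hA : A ⊆ U), IsCompact A →
        ∀ η : MultiIndex m q → VectorMeasure A H, (∀ α, IsRadon (η α)) →
        ∃ k : KernelSpace K hK, IsPotential K hK (Set.inclusion hA) η k ∧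
          DerivativeFormula K (Set.inclusion hA) η ∧
          DoubleIntegralFormula K (Set.inclusion hA) η (inner ℂ k k) ∧
          DensityFormula K (Set.inclusion hA) η (inner ℂ k k)) ∧
      (IsCqUniversal q K hK ↔
        ∀ (A : Set (EuclideanSpace ℝ (Fin m))) (hA : A ⊆ U), IsCompact A →
          closure (interior A) = A →
          ∀ η : MultiIndex m q → VectorMeasure A H, (∀ α, IsRadon (η α)) →
          (∃ G : MultiIndex m q → A → H, IsCqClosure hA G ∧
            ∑ α, bartleIntegral (G α) (η α) ≠ 0) →
          ∃ k : KernelSpace K hK, IsPotential K hK (Set.inclusion hA) η k ∧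
            0 < inner ℂ k k)) := by
  refine ⟨fun hE => ?_, fun hE => ?_⟩
  · have hE' : ∀ f : KernelSpace K hK, IsCq q (f : U → H) := fun f => (hE f).1
    refine ⟨hasKernelDerivatives_of_kernelSpace hU hE' hE, fun η hη => ?_,
      isC0qUniversal_iff hU hE⟩
    have (α : MultiIndex m q) : IsFiniteMeasure (η α).variation := (hη α).1
    obtain ⟨k, -, hk⟩ := exists_isPotential hU hE' fun α f =>
      integrable_of_tendsto_cocompact (μ := (η α).variation) ((hE f).2 α).1 ((hE f).2 α).2
    exact ⟨k, hk⟩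
  · refine ⟨hasKernelDerivatives_of_kernelSpace hU hE hE, fun A hA hAc η hη => ?_,
      isCqUniversal_iff hU hE⟩
    have : CompactSpace A := isCompact_iff_compactSpace.1 hAc
    have (α : MultiIndex m q) : IsFiniteMeasure (η α).variation := (hη α).1
    obtain ⟨k, -, hk⟩ := exists_isPotential hU hE fun α f =>
      integrable_of_tendsto_cocompact (μ := (η α).variation)
        (((hE f).continuous_dAlpha hU α).comp (continuous_inclusion hA)) (by simp)
    exact ⟨k, hk⟩

theorem mainTheorem4 {H : Type*} [NormedAddCommGroup H] [InnerProductSpace ℂ H] [CompleteSpace H]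
    [TopologicalSpace.SeparableSpace H] (m q : ℕ) (U : Set (EuclideanSpace ℝ (Fin m)))
    (hU : IsOpen U) (K : U → U → H →L[ℂ] H) (hK : IsPositiveDefiniteKernel K) :
    -- the case of `C^q_0(U, H)`
    ((∀ F : KernelSpace K hK, IsC0q q (F : U → H)) →
      HasKernelDerivatives q K (IsC0q q) ∧
      (∀ η : MultiIndex m q → VectorMeasure U H, (∀ α, IsRadon (η α)) →
        ∃ k : KernelSpace K hK, IsPotential K hK id η k ∧ DerivativeFormula K id η ∧
          DoubleIntegralFormula K id η (inner ℂ k k) ∧ DensityFormula K id η (inner ℂ k k)) ∧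
      (IsC0qUniversal q K hK ↔
        ∀ η : MultiIndex m q → VectorMeasure U H, (∀ α, IsRadon (η α)) →
          (∃ F : U → H, IsC0q q F ∧ ∑ α, bartleIntegral (dAlpha α.1 F) (η α) ≠ 0) →
          ∃ k : KernelSpace K hK, IsPotential K hK id η k ∧ 0 < inner ℂ k k)) ∧
    -- the case of `C^q(U, H)`
    ((∀ F : KernelSpace K hK, IsCq q (F : U → H)) →
      HasKernelDerivatives q K (IsCq q) ∧
      (∀ (A : Set (EuclideanSpace ℝ (Fin m))) (hA : A ⊆ U), IsCompact A →
        closure (interior A) = A →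
        ∀ η : MultiIndex m q → VectorMeasure A H, (∀ α, IsRadon (η α)) →
        ∃ k : KernelSpace K hK, IsPotential K hK (Set.inclusion hA) η k ∧
          DerivativeFormula K (Set.inclusion hA) η ∧
          DoubleIntegralFormula K (Set.inclusion hA) η (inner ℂ k k) ∧
          DensityFormula K (Set.inclusion hA) η (inner ℂ k k)) ∧
      (IsCqUniversal q K hK ↔
        ∀ (A : Set (EuclideanSpace ℝ (Fin m))) (hA : A ⊆ U), IsCompact A →
          closure (interior A) = A →
          ∀ η : MultiIndex m q → VectorMeasure A H, (∀ α, IsRadon (η α)) →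
          (∃ G : MultiIndex m q → A → H, IsCqClosure hA G ∧
            ∑ α, bartleIntegral (G α) (η α) ≠ 0) →
          ∃ k : KernelSpace K hK, IsPotential K hK (Set.inclusion hA) η k ∧
            0 < inner ℂ k k)) := by
  have h := mainTheorem4_general m q U hU K hK
  exact ⟨h.1, fun hE =>
    ⟨(h.2 hE).1, fun A hA hAc _ => (h.2 hE).2.1 A hA hAc, (h.2 hE).2.2⟩⟩
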